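/- Let $n\ge 1$ and $k\ge 0$ be integers and let $m=kn+1$. An affine permutation is a bijection $\omega:\mathbb Z\to\mathbb Z$ with $\omega(x+n)=\omega(x)+n$ for all $x$ and $\sum_{i=1}^n\omega(i)=\frac{n(n+1)}2$. It is $m$-stable if $\omega(x+m)>\omega(x)$ for all $x\in\mathbb Z$; let $\widetilde S_n^m$ be the set of $m$-stable affine permutations. For $\omega\in\widetilde S_n^m$ define $\mathrm{PS}_\omega:\{1,\dots,n\}\to\mathbb Z_{\ge0}$ by $$\mathrm{PS}_\omega(\alpha)=\#\{\beta\in\mathbb Z:\ \beta>\alpha,\ 0<\omega^{-1}(\alpha)-\omega^{-1}(\beta)<m\}.$$ An $m/n$-parking function is a function $f:\{1,\dots,n\}\to\mathbb Z_{\ge0}$ such that the Young diagram with row lengths $f(1),\dots,f(n)$, put in decreasing order from bottom to top, fits under the diagonal (from the upper left to the lower right corner) of the rectangle of height $n$ and width $m$. Let $\mathrm{PF}_{m/n}$ be the set of these functions. Let $V=\{x\in\mathbb R^n: x_1+\dots+x_n=0\}$ and $H_{ij}^\ell=\{x\in V: x_i-x_j=\ell\}$. Alcoves are the connected components of the complement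 in $V$ of all hyperplanes $H_{ij}^\ell$ with $1\le i<j\le n$, $\ell\in\mathbb Z$. The $k$-Shi regions are the connected components of the complement in $V$ of the hyperplanes $H_{ij}^\ell$ with $1\le i<j\le n$, $-k<\ell\le k$; let $\mathrm{Reg}_n^k$ be the set of $k$-Shi regions. Let $A_0=\{x\in V: x_1>x_2>\dots>x_n>x_1-1\}$ be the fundamental alcove. An affine permutation acts on $V$ by $(\omega x)_i=x_{\omega^{-1}(i)}$, where the coordinates of $x$ are extended to indices in $\mathbb Z$ by $x_{i+n}=x_i-1$. The minimal alcove of a $k$-Shi region $R$ is the unique alcove contained in $R$ that is separated from $A_0$ by the least number of the hyperplanes $H_{ij}^\ell$ ($i<j$, $\ell\in\mathbb Z$). The Pak--Stanley labeling assigns to a $k$-Shi region $R$ the function $\lambda_R:\{1,\dots,n\}\to\mathbb Z_{\ge0}$ for which $\lambda_R(a)$ is the number of hyperplanes $H_{ij}^\ell$ with $i<j$, $-k<\ell\le k$ that separate $R$ from $A_0$ and satisfy either $\ell\le 0$ and $i=a$, or $\ell>0$ and $j=a$. **Theorem.** For every $\omega\in\widetilde S_n^{kn+1}$ the alcove $\omega(A_0)$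 is the minimal alcove of a (unique) $k$-Shi region $\mathrm{alc}(\omega)$, and the resulting map $\mathrm{alc}:\widetilde S_n^{kn+1}\to\mathrm{Reg}_n^k$ is a bijection. One has $\lambda\circ\mathrm{alc}=\mathrm{PS}$, that is, $\lambda_{\mathrm{alc}(\omega)}=\mathrm{PS}_\omega$ for all $\omega\in\widetilde S_n^{kn+1}$. In particular, $\mathrm{PS}$ is a bijection from $\widetilde S_n^{kn+1}$ onto $\mathrm{PF}_{(kn+1)/n}$. -/

import Mathlib

namespace ShiParking

/-- An affine `S_n`-permutation: a bijection `ω : ℤ → ℤ` with `ω (x + n) = ω x + n` for all `x`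
and `ω 1 + ⋯ + ω n = n (n + 1) / 2`. -/
def IsAffinePerm (n : ℕ) (ω : Equiv.Perm ℤ) : Prop :=
  (∀ x : ℤ, ω (x + n) = ω x + n) ∧
    ∑ i ∈ Finset.Icc (1 : ℤ) n, ω i = (n : ℤ) * (n + 1) / 2

/-- The set of `m`-stable affine permutations. -/
def stablePerms (n m : ℕ) : Set (Equiv.Perm ℤ) :=
  {ω | IsAffinePerm n ω ∧ ∀ x : ℤ, ω x < ω (x + m)}

/-- The element of `{1, …, n}` that corresponds to an index in `Fin n = {0, …, n - 1}`. -/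
def pos {n : ℕ} (a : Fin n) : ℤ := (a : ℤ) + 1

/-- `PS_ω(α) = #{β > α : 0 < ω⁻¹(α) - ω⁻¹(β) < m}` for `α ∈ {1, …, n}`. -/
noncomputable def PS (n m : ℕ) (ω : Equiv.Perm ℤ) : Fin n → ℕ := fun a =>
  Set.ncard {β : ℤ | pos a < β ∧ 0 < ω⁻¹ (pos a) - ω⁻¹ β ∧ ω⁻¹ (pos a) - ω⁻¹ β < m}

/-- `m/n`-parking functions: the Young diagram whose row lengths, from bottom to top, are the
values of `f` in decreasing order lies under the diagonal, from `(0, n)` to `(m, 0)`, of the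
rectangle of height `n` and width `m`. The upper right corner of the row with index `i`
(counted from `0` at the bottom) is `(f (σ i), i + 1)`. -/
def parkingFunctions (m n : ℕ) : Set (Fin n → ℕ) :=
  {f | ∃ σ : Equiv.Perm (Fin n), Antitone (f ∘ σ) ∧
    ∀ i : Fin n, n * f (σ i) + m * ((i : ℕ) + 1) ≤ m * n}

/-- The space `V = {x ∈ ℝⁿ : x₁ + ⋯ + xₙ = 0}`. -/
def V (n : ℕ) : Set (Fin n → ℝ) := {x | ∑ i, x i = 0}

/-- The hyperplane `H_{ij}^ℓ = {x ∈ V : x_i - x_j = ℓ}`. -/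
def hyperplane (n : ℕ) (i j : Fin n) (l : ℤ) : Set (Fin n → ℝ) :=
  {x | x ∈ V n ∧ x i - x j = l}

/-- The affine braid arrangement. -/
def affineBraid (n : ℕ) : Set (Set (Fin n → ℝ)) :=
  {H | ∃ (i j : Fin n) (l : ℤ), i < j ∧ H = hyperplane n i j l}

/-- The `k`-Shi arrangement. -/
def shi (n k : ℕ) : Set (Set (Fin n → ℝ)) :=
  {H | ∃ (i j : Fin n) (l : ℤ), i < j ∧ -(k : ℤ) < l ∧ l ≤ k ∧ H = hyperplane n i j l}

/-- The connected components of the complement in `V` of an arrangement. -/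
def regions (n : ℕ) (𝒜 : Set (Set (Fin n → ℝ))) : Set (Set (Fin n → ℝ)) :=
  {R | ∃ x ∈ V n \ ⋃₀ 𝒜, R = connectedComponentIn (V n \ ⋃₀ 𝒜) x}

/-- Alcoves are the connected components of the complement of the affine braid arrangement. -/
def alcoves (n : ℕ) : Set (Set (Fin n → ℝ)) := regions n (affineBraid n)

/-- The `k`-Shi regions. -/
def shiRegions (n k : ℕ) : Set (Set (Fin n → ℝ)) := regions n (shi n k)

/-- The fundamental alcove `{x ∈ V : x₁ > x₂ > ⋯ > xₙ > x₁ - 1}`. -/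
def fundAlcove (n : ℕ) [NeZero n] : Set (Fin n → ℝ) :=
  {x | x ∈ V n ∧ (∀ i j : Fin n, i < j → x j < x i) ∧ x 0 - 1 < x (Fin.rev 0)}

/-- The coordinates of a point, with the index set extended to `ℤ` by `x_{i+n} = x_i - 1`. -/
noncomputable def extend (n : ℕ) [NeZero n] (x : Fin n → ℝ) (j : ℤ) : ℝ :=
  x (Fin.ofNat n ((j - 1) % n).toNat) - ((j - 1) / n : ℤ)

/-- The action of affine permutations on points: `(ω x)_i = x_{ω⁻¹(i)}` in extended coordinates.
The transposition of `i, i + 1` (modulo `n`) acts by the reflection in `x_i = x_{i+1}` for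
`1 ≤ i < n`, and by the reflection in `x_1 - x_n = 1` for `i = 0`. -/
noncomputable def act (n : ℕ) [NeZero n] (ω : Equiv.Perm ℤ) (x : Fin n → ℝ) : Fin n → ℝ :=
  fun i => extend n x (ω⁻¹ (pos i))

/-- The alcove `ω(A₀)`. -/
noncomputable def alcove (n : ℕ) [NeZero n] (ω : Equiv.Perm ℤ) : Set (Fin n → ℝ) :=
  act n ω '' fundAlcove n

/-- The set `R` lies in the open half-space bounded by `H_{ij}^ℓ` that does not contain the
fundamental alcove, that is, `H_{ij}^ℓ` separates `R` from the fundamental alcove. -/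
def Separates (n : ℕ) [NeZero n] (i j : Fin n) (l : ℤ) (R : Set (Fin n → ℝ)) : Prop :=
  ((∀ x ∈ fundAlcove n, x i - x j < l) ∧ ∀ y ∈ R, (l : ℝ) < y i - y j) ∨
    ((∀ x ∈ fundAlcove n, (l : ℝ) < x i - x j) ∧ ∀ y ∈ R, y i - y j < l)

/-- The number of hyperplanes of the affine braid arrangement that separate `A` from the
fundamental alcove. (Different triples `(i, j, ℓ)` with `i < j` give different hyperplanes.) -/
noncomputable def numSeparating (n : ℕ) [NeZero n] (A : Set (Fin n → ℝ)) : ℕ :=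
  Set.ncard {t : Fin n × Fin n × ℤ | t.1 < t.2.1 ∧ Separates n t.1 t.2.1 t.2.2 A}

/-- `A` is the minimal alcove of `R`: the unique alcove contained in `R` that is separated from
the fundamental alcove by the least number of hyperplanes. -/
def IsMinimalAlcove (n : ℕ) [NeZero n] (R A : Set (Fin n → ℝ)) : Prop :=
  A ∈ alcoves n ∧ A ⊆ R ∧
    ∀ B ∈ alcoves n, B ⊆ R → B ≠ A → numSeparating n A < numSeparating n B

/-- The map `alc`: it sends `ω` to the `k`-Shi region whose minimal alcove is `ω(A₀)`.
There is at most one such region, because `ω(A₀)` is nonempty and distinct regions are disjoint,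
so it is the union of all such regions. -/
noncomputable def alc (n k : ℕ) [NeZero n] (ω : Equiv.Perm ℤ) : Set (Fin n → ℝ) :=
  ⋃₀ {R | R ∈ shiRegions n k ∧ IsMinimalAlcove n R (alcove n ω)}

/-- The Pak–Stanley labeling: a hyperplane `H_{ij}^ℓ` of the `k`-Shi arrangement (`i < j`,
`-k < ℓ ≤ k`) that separates `R` from the fundamental alcove contributes `1` to the `i`-th
coordinate if `ℓ ≤ 0`, and `1` to the `j`-th coordinate if `ℓ > 0`. -/
noncomputable def pakStanley (n k : ℕ) [NeZero n] (R : Set (Fin n → ℝ)) : Fin n → ℕ := fun a =>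
  Set.ncard {t : Fin n × ℤ | a < t.1 ∧ -(k : ℤ) < t.2 ∧ t.2 ≤ 0 ∧ Separates n a t.1 t.2 R} +
  Set.ncard {t : Fin n × ℤ | t.1 < a ∧ 0 < t.2 ∧ t.2 ≤ k ∧ Separates n t.1 a t.2 R}

end ShiParking

/-! The dictionary: extend the coordinates of a point to all integers by `x_{i+n} = x_i - 1`. A
point lies in `ω(A₀)` exactly when its extended coordinates are ordered oppositely to `ω⁻¹`
(`mem_alcove_iff`). Hyperplanes separating it from `A₀` correspond, up to shifts by `n`, to
inversions `a < b`, `ω⁻¹ b < ω⁻¹ a`, and the `k`-Shi hyperplanes to the pairs with `b < a + k n`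
(`beyond_imp_iff`).

Minimal alcoves: for `m = k n + 1`, stability reads `ω x < ω (x + 1) + k n`, so no descent between
adjacent positions is as large as `k n`. Then all inversions follow by transitivity from those of
height less than `k n` (`lt_of_inversion`). Any alcove in the same Shi region shares the latter, so
it has all the inversions of `ω`, and `ω(A₀)` is minimal. Conversely, a violation of stability can
be undone by exchanging two adjacent positions modulo `n`: this stays in the region and removes
inversions (`mem_stablePerms_of_minimal`).

Labels: the inversions of `a` in one residue class modulo `n` form an interval. The Shi hyperplanes
see its first `k` members, `PS` its last `k`, and reflecting the interval matches the two
(`pakStanley_alc`).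

Bijectivity of `PS`: it takes values in parking functions by `exists_PS_le`. For injectivity
(`injOn_PS`), follow the least positions, in each class modulo `m`, of values above `α`. As `α`
grows these generators jump one at a time, and the label is the rank of the one that jumps. For two
permutations with the same label, the squared distance of the generators paired in order cannot
increase with `α` but is periodic, so the pairing is constant; this makes the permutations
translates of each other.

Surjectivity is a count through vectors modulo `m` with a prescribed sum. Each translation class of
vectors contains at most one parking function (`eq_of_mem_parkingFunctions`), and each vector of the
prescribed sum is realized by the positions of `1, …, n` in a stable permutation
(`exists_stablePerm`). -/

namespace ShiParking

/-- The index in `Fin n` of the residue class of an integer. -/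
def res (n : ℕ) [NeZero n] (j : ℤ) : Fin n := Fin.ofNat n ((j - 1) % n).toNat

lemma pos_pos {n : ℕ} (a : Fin n) : 0 < pos a := by unfold pos; omega

lemma pos_le {n : ℕ} (a : Fin n) : pos a ≤ n := by unfold pos; omega

lemma pos_lt_pos {n : ℕ} {a b : Fin n} : pos a < pos b ↔ a < b := by
  unfold pos; rw [Fin.lt_def]; omega

lemma perm_apply_inv (ω : Equiv.Perm ℤ) (x : ℤ) : ω (ω⁻¹ x) = x := ω.apply_symm_apply x

lemma perm_inv_apply (ω : Equiv.Perm ℤ) (x : ℤ) : ω⁻¹ (ω x) = x := ω.symm_apply_apply x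

/-! ### Maps of the integers that commute with the shift by `n` -/

section Basics

variable {n : ℕ} [NeZero n]

lemma cast_pos_of_neZero (n : ℕ) [NeZero n] : (0 : ℤ) < n := by
  exact_mod_cast Nat.pos_of_ne_zero (NeZero.ne n)

lemma pos_res_add (j : ℤ) : pos (res n j) + (j - 1) / n * n = j := by
  have hn := cast_pos_of_neZero n
  have h1 := Int.emod_nonneg (j - 1) hn.ne'
  have h2 := Int.emod_lt_of_pos (j - 1) hn
  have h3 := Int.emod_add_mul_ediv (j - 1) n
  have h4 : (((j - 1) % n).toNat % n : ℕ) = ((j - 1) % n).toNat :=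
    Nat.mod_eq_of_lt (by omega)
  unfold pos res
  simp only [Fin.ofNat, h4]
  rw [Int.toNat_of_nonneg h1]
  linarith

lemma exists_eq_pos_add (j : ℤ) : ∃ (a : Fin n) (t : ℤ), j = pos a + t * n :=
  ⟨_, _, (pos_res_add j).symm⟩

lemma pos_add_inj {a b : Fin n} {s t : ℤ} (h : pos a + s * n = pos b + t * n) :
    a = b ∧ s = t := by
  have hn := cast_pos_of_neZero n
  have ha := pos_pos a
  have ha' := pos_le a
  have hb := pos_pos b
  have hb' := pos_le b
  have hst : s = t := by
    rcases lt_trichotomy s t with h' | h' | h'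
    · nlinarith
    · exact h'
    · nlinarith
  subst hst
  refine ⟨?_, rfl⟩
  have : pos a = pos b := by linarith
  unfold pos at this
  exact Fin.ext (by omega)

lemma pos_injective : Function.Injective (pos : Fin n → ℤ) := fun a b h =>
  (pos_add_inj (s := 0) (t := 0) (by simpa using h)).1

lemma res_pos_add (a : Fin n) (t : ℤ) : res n (pos a + t * n) = a :=
  (pos_add_inj (pos_res_add (n := n) (pos a + t * n))).1

lemma div_pos_add (a : Fin n) (t : ℤ) : (pos a + t * n - 1) / n = t :=
  (pos_add_inj (pos_res_add (n := n) (pos a + t * n))).2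

lemma map_add_mul_of_map_add {G : Type*} [AddCommGroup G] {f : ℤ → G} {N : ℤ} {c : G}
    (h : ∀ x, f (x + N) = f x + c) (x t : ℤ) : f (x + t * N) = f x + t • c := by
  induction t using Int.induction_on with
  | zero => simp
  | succ i ih => rw [add_mul, one_mul, ← add_assoc, h, ih, add_zsmul, one_zsmul, add_assoc]
  | pred i ih =>
    have := h (x + (-(i : ℤ) - 1) * N)
    rw [show x + (-(i : ℤ) - 1) * N + N = x + -(i : ℤ) * N by ring, ih] at this
    rw [sub_zsmul, one_zsmul, ← add_assoc, this, add_neg_cancel_right]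

lemma equivariant_add_mul {f : ℤ → ℤ} {N c : ℤ} (h : ∀ x, f (x + N) = f x + c) (x t : ℤ) :
    f (x + t * N) = f x + t * c := by
  simpa using map_add_mul_of_map_add h x t

/-- An injective map that commutes with the shift by `n` permutes the residue classes. -/
lemma bijective_res_comp {τ : ℤ → ℤ} (hτ : Function.Injective τ)
    (h : ∀ x, τ (x + n) = τ x + n) : Function.Bijective fun a : Fin n => res n (τ (pos a)) := by
  refine Finite.injective_iff_bijective.1 fun a b hab => ?_
  have ha := pos_res_add (n := n) (τ (pos a))
  have hb := pos_res_add (n := n) (τ (pos b))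
  rw [show res n (τ (pos a)) = res n (τ (pos b)) from hab] at ha
  set s := (τ (pos a) - 1) / n
  set t := (τ (pos b) - 1) / n
  have h1 : τ (pos a + t * n) = τ (pos b + s * n) := by
    rw [equivariant_add_mul h, equivariant_add_mul h]; linarith
  exact (pos_add_inj (hτ h1)).1

lemma surjective_of_equivariant {τ : ℤ → ℤ} (hτ : Function.Injective τ)
    (h : ∀ x, τ (x + n) = τ x + n) : Function.Surjective τ := fun j => by
  obtain ⟨a, ha⟩ := (bijective_res_comp hτ h).2 (res n j)
  simp only at ha
  have h1 := pos_res_add (n := n) (τ (pos a))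
  have h2 := pos_res_add (n := n) j
  rw [ha] at h1
  refine ⟨pos a + ((j - 1) / n - (τ (pos a) - 1) / n) * n, ?_⟩
  rw [equivariant_add_mul h]
  linarith

/-- Sums of `n`-periodic functions over a period are invariant under reindexing. -/
lemma sum_comp_pos {M : Type*} [AddCommGroup M] {p : ℤ → M} (hp : ∀ x, p (x + n) = p x)
    {τ : ℤ → ℤ} (hτ : Function.Injective τ) (h : ∀ x, τ (x + n) = τ x + n) :
    ∑ a : Fin n, p (τ (pos a)) = ∑ a : Fin n, p (pos a) := by
  rw [← (bijective_res_comp hτ h).sum_comp fun a => p (pos a)]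
  refine Finset.sum_congr rfl fun a _ => ?_
  conv_lhs => rw [← pos_res_add (n := n) (τ (pos a))]
  rw [map_add_mul_of_map_add (f := p) (c := 0) (by simpa using hp)]
  simp

lemma sum_Icc_eq_sum_pos {M : Type*} [AddCommMonoid M] (f : ℤ → M) :
    ∑ i ∈ Finset.Icc (1 : ℤ) n, f i = ∑ a : Fin n, f (pos a) := by
  symm
  refine Finset.sum_bij (fun a _ => pos a) (fun a _ => ?_) (fun a _ b _ h => pos_injective h)
    (fun b hb => ?_) (fun _ _ => rfl)
  · exact Finset.mem_Icc.2 ⟨pos_pos a, pos_le a⟩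
  · obtain ⟨h1, h2⟩ := Finset.mem_Icc.1 hb
    exact ⟨⟨(b - 1).toNat, by omega⟩, Finset.mem_univ _, by simp only [pos]; omega⟩

lemma sum_pos (n : ℕ) : ∑ a : Fin n, pos a = (n : ℤ) * (n + 1) / 2 := by
  have h : ∑ a : Fin n, pos a * 2 = (n : ℤ) * (n + 1) := by
    unfold pos
    rw [Fin.sum_univ_eq_sum_range (fun i => ((i : ℤ) + 1) * 2)]
    induction n with
    | zero => simp
    | succ n ih => rw [Finset.sum_range_succ, ih]; push_cast; ring
  rw [← h, ← Finset.sum_mul, Int.mul_ediv_cancel _ two_ne_zero]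

lemma isAffinePerm_iff {ω : Equiv.Perm ℤ} : IsAffinePerm n ω ↔
    (∀ x : ℤ, ω (x + n) = ω x + n) ∧ ∑ a : Fin n, ω (pos a) = ∑ a : Fin n, pos a := by
  rw [IsAffinePerm, sum_Icc_eq_sum_pos, sum_pos]

lemma equivariant_inv {ω : Equiv.Perm ℤ} {c d : ℤ} (h : ∀ x : ℤ, ω (x + c) = ω x + d) (x : ℤ) :
    ω⁻¹ (x + d) = ω⁻¹ x + c := by
  rw [Equiv.Perm.inv_eq_iff_eq, h, perm_apply_inv]

/-- The function `ω⁻¹ x - x` is periodic, so its sum over a window agrees with that over the image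
of the window under `ω`; this transfers the normalization. -/
lemma IsAffinePerm.inv {ω : Equiv.Perm ℤ} (h : IsAffinePerm n ω) : IsAffinePerm n ω⁻¹ := by
  rw [isAffinePerm_iff] at h ⊢
  obtain ⟨h1, h2⟩ := h
  refine ⟨equivariant_inv h1, ?_⟩
  have h3 := sum_comp_pos (n := n) (p := fun x => ω⁻¹ x - x)
    (fun x => by simp only [equivariant_inv h1]; ring) ω.injective h1
  simp only [perm_inv_apply, Finset.sum_sub_distrib] at h3
  linarith

/-- The sum of an equivariant permutation over a period is normalized up to a multiple
of `n`. -/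
lemma dvd_sum_sub_sum_pos {τ : ℤ → ℤ} (hτ : Function.Injective τ)
    (h : ∀ x, τ (x + n) = τ x + n) : (n : ℤ) ∣ ∑ a : Fin n, τ (pos a) - ∑ a : Fin n, pos a := by
  rw [← Int.modEq_iff_dvd, ← ZMod.intCast_eq_intCast_iff]
  push_cast
  exact (sum_comp_pos (p := fun x : ℤ => (x : ZMod n)) (fun x => by simp) hτ h).symm

/-- A strictly monotone bijection of `ℤ` is a translation. -/
lemma eq_add_of_strictMono {f : ℤ → ℤ} (hf : StrictMono f) (hs : Function.Surjective f) (x : ℤ) :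
    f x = x + f 0 := by
  have h1 : ∀ x, f (x + 1) = f x + 1 := fun x => by
    obtain ⟨z, hz⟩ := hs (f x + 1)
    have h2 : x < z := hf.lt_iff_lt.1 (by omega)
    have h3 : f (x + 1) ≤ f z := hf.monotone h2
    have h4 := hf (lt_add_one x)
    omega
  have := equivariant_add_mul (N := 1) (c := 1) h1 0 x
  simp at this
  omega

lemma eq_of_forall_eq_add {ω ω' : Equiv.Perm ℤ} (h : IsAffinePerm n ω) (h' : IsAffinePerm n ω')
    {d : ℤ} (hd : ∀ x, ω⁻¹ x = ω'⁻¹ x + d) : ω = ω' := by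
  have h1 := (isAffinePerm_iff.1 h.inv).2
  have h2 := (isAffinePerm_iff.1 h'.inv).2
  have hn := cast_pos_of_neZero n
  simp only [hd, Finset.sum_add_distrib, Finset.sum_const, Finset.card_univ, Fintype.card_fin,
    nsmul_eq_mul] at h1
  have h3 : d = 0 := by
    have : (n : ℤ) * d = 0 := by linarith
    rcases mul_eq_zero.1 this with h | h
    · omega
    · exact h
  exact inv_injective (Equiv.ext fun x => by rw [hd, h3, add_zero])

/-- An affine permutation is determined by the order of its preimages. -/
lemma eq_of_order {ω ω' : Equiv.Perm ℤ} (h : IsAffinePerm n ω) (h' : IsAffinePerm n ω')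
    (ho : ∀ a b, ω⁻¹ a < ω⁻¹ b ↔ ω'⁻¹ a < ω'⁻¹ b) : ω = ω' := by
  have hm : StrictMono fun x => ω⁻¹ (ω' x) := fun x y hxy => by
    rw [ho]; simpa using hxy
  have hs : Function.Surjective fun x => ω⁻¹ (ω' x) :=
    ω⁻¹.surjective.comp ω'.surjective
  refine eq_of_forall_eq_add h h' (d := ω⁻¹ (ω' 0)) fun x => ?_
  simpa using eq_add_of_strictMono hm hs (ω'⁻¹ x)

/-- A quasi-periodic injective function is ordered like an equivariant permutation. -/
lemma exists_rank {h : ℤ → ℝ} (hi : Function.Injective h) {N : ℝ} (hN : 0 < N)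
    (hp : ∀ j, h (j + n) = h j + N) :
    ∃ ρ : Equiv.Perm ℤ, (∀ x, ρ (x + n) = ρ x + n) ∧ ∀ i j, ρ i < ρ j ↔ h i < h j := by
  -- The summand of `a` is a signed count of the elements of the class of `a`, from `pos a` on, that
  -- lie below `j` in the order of `h`.
  set r : ℤ → ℤ := fun j => ∑ a : Fin n, ⌈(h j - h (pos a)) / N⌉ with hr
  have h1 : ∀ x, r (x + n) = r x + n := fun x => by
    have h2 : ∀ a : Fin n, ⌈(h (x + n) - h (pos a)) / N⌉ = ⌈(h x - h (pos a)) / N⌉ + 1 :=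
      fun a => by
        rw [← Int.ceil_add_one]
        congr 1
        rw [hp]
        field_simp
        ring
    simp [hr, h2, Finset.sum_add_distrib]
  have h2 : ∀ i j, h i < h j → r i < r j := fun i j hij => by
    refine Finset.sum_lt_sum (fun a _ => ?_) ⟨res n i, Finset.mem_univ _, ?_⟩
    · apply Int.ceil_mono; gcongr
    -- For the class of `i` itself the quotient is an integer, so its ceiling increases strictly
    -- from `i` to `j`.
    · have h3 : h i = h (pos (res n i)) + ((i - 1) / n : ℤ) * N := by
        conv_lhs => rw [← pos_res_add (n := n) i]
        rw [map_add_mul_of_map_add hp]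
        simp
      have h4 : (h i - h (pos (res n i))) / N = ((i - 1) / n : ℤ) := by
        rw [h3]; field_simp; ring
      rw [h4, Int.ceil_intCast, Int.lt_ceil, ← h4]
      gcongr
  have h3 : Function.Injective r := fun i j hij => by
    by_contra hne
    rcases lt_or_gt_of_ne (hi.ne hne) with h | h
    · exact (h2 _ _ h).ne hij
    · exact (h2 _ _ h).ne' hij
  refine ⟨Equiv.ofBijective r ⟨h3, surjective_of_equivariant h3 h1⟩, h1, fun i j => ⟨fun hij => ?_,
    h2 i j⟩⟩
  by_contra hn
  rcases (not_lt.1 hn).lt_or_eq with h | h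
  · exact absurd hij (h2 _ _ h).not_gt
  · exact absurd hij (by rw [hi h]; exact lt_irrefl _)

end Basics

/-! ### Regions of an arrangement as sets of points with the same signs -/

/-- The arrangement of the hyperplanes whose indices belong to `S`. -/
def arrangement {n : ℕ} (S : Set (Fin n × Fin n × ℤ)) : Set (Set (Fin n → ℝ)) :=
  {H | ∃ t ∈ S, H = hyperplane n t.1 t.2.1 t.2.2}

/-- The indices of the hyperplanes of the affine braid arrangement. -/
def braidIndex (n : ℕ) : Set (Fin n × Fin n × ℤ) := {t | t.1 < t.2.1}

/-- The indices of the hyperplanes of the `k`-Shi arrangement. -/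
def shiIndex (n k : ℕ) : Set (Fin n × Fin n × ℤ) :=
  {t | t.1 < t.2.1 ∧ -(k : ℤ) < t.2.2 ∧ t.2.2 ≤ k}

/-- The points on the same side as `x` of every hyperplane with index in `S`. -/
def cell {n : ℕ} (S : Set (Fin n × Fin n × ℤ)) (x : Fin n → ℝ) : Set (Fin n → ℝ) :=
  {z | z ∈ V n ∧ ∀ t ∈ S, (x t.1 - x t.2.1 < t.2.2 ∧ z t.1 - z t.2.1 < t.2.2) ∨
    ((t.2.2 : ℝ) < x t.1 - x t.2.1 ∧ (t.2.2 : ℝ) < z t.1 - z t.2.1)}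

/-- The point `x` lies on no hyperplane with index in `S`. -/
def Generic {n : ℕ} (S : Set (Fin n × Fin n × ℤ)) (x : Fin n → ℝ) : Prop :=
  x ∈ V n ∧ ∀ t ∈ S, x t.1 - x t.2.1 ≠ t.2.2

/-- The hyperplane `H_{ij}^ℓ` (for `i < j`) separates `x` from the fundamental alcove. -/
def Beyond {n : ℕ} (x : Fin n → ℝ) (i j : Fin n) (l : ℤ) : Prop :=
  (1 ≤ l ∧ (l : ℝ) < x i - x j) ∨ (l ≤ 0 ∧ x i - x j < l)

section Cells

variable {n : ℕ} {S : Set (Fin n × Fin n × ℤ)} {x y z : Fin n → ℝ}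

lemma affineBraid_eq (n : ℕ) : affineBraid n = arrangement (braidIndex n) := by
  ext H
  simp only [affineBraid, arrangement, braidIndex, Set.mem_ofPred_eq, Prod.exists]

lemma shi_eq (n k : ℕ) : shi n k = arrangement (shiIndex n k) := by
  ext H
  simp only [shi, arrangement, shiIndex, Set.mem_ofPred_eq, Prod.exists, and_assoc]

lemma shiIndex_subset (n k : ℕ) : shiIndex n k ⊆ braidIndex n := fun _ ht => ht.1

lemma mem_diff_iff : x ∈ V n \ ⋃₀ arrangement S ↔ Generic S x := by
  simp only [Set.mem_sdiff, Set.mem_sUnion, arrangement, Set.mem_ofPred_eq, Generic, hyperplane]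
  refine and_congr_right fun hx => ⟨fun h t ht he => h ⟨_, ⟨t, ht, rfl⟩, hx, he⟩, ?_⟩
  rintro h ⟨_, ⟨t, ht, rfl⟩, -, he⟩
  exact h t ht he

lemma Generic.mono {T : Set (Fin n × Fin n × ℤ)} (h : Generic S x) (hT : T ⊆ S) : Generic T x :=
  ⟨h.1, fun t ht => h.2 t (hT ht)⟩

lemma Generic.mem_cell (h : Generic S x) : x ∈ cell S x :=
  ⟨h.1, fun t ht => (h.2 t ht).lt_or_gt.imp (fun h => ⟨h, h⟩) fun h => ⟨h, h⟩⟩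

lemma generic_of_mem_cell (h : z ∈ cell S x) : Generic S z :=
  ⟨h.1, fun t ht => (h.2 t ht).elim (fun h => h.2.ne) fun h => h.2.ne'⟩

lemma convex_cell : Convex ℝ (cell S x) := by
  have hV : Convex ℝ (V n) := by
    intro a ha b hb s t _ _ _
    simp only [V, Set.mem_ofPred_eq] at ha hb ⊢
    simp [Finset.sum_add_distrib, ← Finset.mul_sum, ha, hb]
  have hc : cell S x = V n ∩ ⋂ t ∈ S, {z | (x t.1 - x t.2.1 < t.2.2 ∧ z t.1 - z t.2.1 < t.2.2) ∨
      ((t.2.2 : ℝ) < x t.1 - x t.2.1 ∧ (t.2.2 : ℝ) < z t.1 - z t.2.1)} := by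
    ext z
    simp [cell]
  rw [hc]
  refine hV.inter (convex_iInter₂ fun t _ => ?_)
  have hl : IsLinearMap ℝ fun z : Fin n → ℝ => z t.1 - z t.2.1 :=
    ⟨fun a b => by simp; ring, fun c a => by simp; ring⟩
  by_cases h : x t.1 - x t.2.1 < t.2.2
  · simpa [h, h.not_gt] using convex_halfSpace_lt hl _
  · by_cases h' : (t.2.2 : ℝ) < x t.1 - x t.2.1
    · simpa [h, h'] using convex_halfSpace_gt hl _
    · simpa [h, h'] using convex_empty

/-- By the intermediate value theorem a linear form that avoids a level on a connected set stays on
one side of it; conversely a cell is convex. -/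
lemma connectedComponentIn_eq_cell (hx : Generic S x) :
    connectedComponentIn (V n \ ⋃₀ arrangement S) x = cell S x := by
  have hxd := mem_diff_iff.2 hx
  refine subset_antisymm (fun z hz => ?_) ?_
  · have hsub := connectedComponentIn_subset (V n \ ⋃₀ arrangement S) x
    refine ⟨(hsub hz).1, fun t ht => ?_⟩
    have hx' := mem_connectedComponentIn hxd
    have hf : ContinuousOn (fun y : Fin n → ℝ => y t.1 - y t.2.1)
        (connectedComponentIn (V n \ ⋃₀ arrangement S) x) := by fun_prop
    have hne : ∀ y ∈ connectedComponentIn (V n \ ⋃₀ arrangement S) x, y t.1 - y t.2.1 ≠ t.2.2 :=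
      fun y hy => (mem_diff_iff.1 (hsub hy)).2 t ht
    rcases (hne x hx').lt_or_gt with h | h
    · refine Or.inl ⟨h, ?_⟩
      by_contra hz'
      obtain ⟨y, hy, he⟩ := isPreconnected_connectedComponentIn.intermediate_value hx' hz hf
        ⟨h.le, not_lt.1 hz'⟩
      exact hne y hy he
    · refine Or.inr ⟨h, ?_⟩
      by_contra hz'
      obtain ⟨y, hy, he⟩ := isPreconnected_connectedComponentIn.intermediate_value hz hx' hf
        ⟨not_lt.1 hz', h.le⟩
      exact hne y hy he
  · exact convex_cell.isPreconnected.subset_connectedComponentIn hx.mem_cell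
      fun z hz => mem_diff_iff.2 (generic_of_mem_cell hz)

lemma mem_regions_iff {R : Set (Fin n → ℝ)} :
    R ∈ regions n (arrangement S) ↔ ∃ x, Generic S x ∧ R = cell S x := by
  constructor
  · rintro ⟨x, hx, rfl⟩
    exact ⟨x, mem_diff_iff.1 hx, connectedComponentIn_eq_cell (mem_diff_iff.1 hx)⟩
  · rintro ⟨x, hx, rfl⟩
    exact ⟨x, mem_diff_iff.2 hx, (connectedComponentIn_eq_cell hx).symm⟩

lemma mem_shiRegions_iff {k : ℕ} {R : Set (Fin n → ℝ)} :
    R ∈ shiRegions n k ↔ ∃ x, Generic (shiIndex n k) x ∧ R = cell (shiIndex n k) x := by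
  rw [shiRegions, shi_eq, mem_regions_iff]

lemma mem_alcoves_iff {R : Set (Fin n → ℝ)} :
    R ∈ alcoves n ↔ ∃ x, Generic (braidIndex n) x ∧ R = cell (braidIndex n) x := by
  rw [alcoves, affineBraid_eq, mem_regions_iff]

lemma cell_eq_of_mem (hz : z ∈ cell S x) : cell S z = cell S x := by
  ext w
  simp only [cell, Set.mem_ofPred_eq]
  refine and_congr_right fun _ => forall₂_congr fun t ht => ?_
  rcases hz.2 t ht with h | h
  · simp [h.1, h.2, h.1.not_gt, h.2.not_gt]
  · simp [h.1, h.2, h.1.not_gt, h.2.not_gt]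

lemma mem_cell_iff (hx : Generic S x) (hz : Generic S z) :
    z ∈ cell S x ↔ ∀ t ∈ S, (Beyond x t.1 t.2.1 t.2.2 ↔ Beyond z t.1 t.2.1 t.2.2) := by
  simp only [cell, Set.mem_ofPred_eq, hz.1, true_and, Beyond]
  refine forall₂_congr fun t ht => ?_
  rcases le_or_gt t.2.2 0 with h | h
  · have h' : ¬ 1 ≤ t.2.2 := by omega
    rcases (hx.2 t ht).lt_or_gt with h1 | h1 <;> rcases (hz.2 t ht).lt_or_gt with h2 | h2 <;>
      simp [h, h', h1, h2, h1.not_gt, h2.not_gt]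
  · have h' : 1 ≤ t.2.2 := by omega
    rcases (hx.2 t ht).lt_or_gt with h1 | h1 <;> rcases (hz.2 t ht).lt_or_gt with h2 | h2 <;>
      simp [h.not_ge, h', h1, h2, h1.not_gt, h2.not_gt]

/-- A cell of a finite arrangement contains a point on no hyperplane of the affine braid
arrangement. -/
lemma exists_generic_mem_cell (hS : S.Finite) (hx : Generic S x) :
    ∃ y ∈ cell S x, Generic (braidIndex n) y := by
  obtain ⟨v, hv, hinj⟩ : ∃ v ∈ V n, Function.Injective v := by
    refine ⟨fun a => a - (∑ b : Fin n, (b : ℝ)) / n, ?_, fun a b h => ?_⟩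
    · rcases Nat.eq_zero_or_pos n with rfl | hn
      · simp [V]
      · simp only [V, Set.mem_ofPred_eq, Finset.sum_sub_distrib, Finset.sum_const,
          Finset.card_univ, Fintype.card_fin, nsmul_eq_mul]
        field_simp
        ring
    · exact Fin.ext (by simpa using h)
  set f : ℝ → Fin n → ℝ := fun e a => x a + e * v a with hf
  have hfV : ∀ e, f e ∈ V n := fun e => by
    have h1 := hx.1
    simp only [V, Set.mem_ofPred_eq] at h1 hv ⊢
    simp [hf, Finset.sum_add_distrib, ← Finset.mul_sum, h1, hv]
  have hfc : Continuous f := by fun_prop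
  have hev : ∀ᶠ e in nhds (0 : ℝ), f e ∈ cell S x := by
    have : ∀ᶠ e in nhds (0 : ℝ), ∀ t ∈ S,
        (x t.1 - x t.2.1 < t.2.2 ∧ f e t.1 - f e t.2.1 < t.2.2) ∨
        ((t.2.2 : ℝ) < x t.1 - x t.2.1 ∧ (t.2.2 : ℝ) < f e t.1 - f e t.2.1) := by
      rw [Filter.eventually_all_finite hS]
      intro t ht
      have hc : Continuous fun e => f e t.1 - f e t.2.1 := by fun_prop
      have h0 : f 0 t.1 - f 0 t.2.1 = x t.1 - x t.2.1 := by simp [hf]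
      rcases (hx.2 t ht).lt_or_gt with h | h
      · filter_upwards [hc.continuousAt.eventually_lt continuousAt_const (h0 ▸ h)] with e he
        exact Or.inl ⟨h, he⟩
      · filter_upwards [continuousAt_const.eventually_lt hc.continuousAt (h0 ▸ h)] with e he
        exact Or.inr ⟨h, he⟩
    exact this.mono fun e he => ⟨hfV e, he⟩
  -- Since the coordinates of `v` are distinct, the line `x + e v` meets each braid hyperplane for
  -- only one `e`; these countably many values are to be avoided.
  set bad : Set ℝ := Set.range fun t : Fin n × Fin n × ℤ =>
    (t.2.2 - (x t.1 - x t.2.1)) / (v t.1 - v t.2.1)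
  have hbad : Dense badᶜ := (Set.countable_range _).dense_compl ℝ
  obtain ⟨e, he, heb⟩ := hbad.inter_nhds_nonempty hev
  refine ⟨f e, heb, hfV e, fun t ht h => he ⟨t, ?_⟩⟩
  have hne : v t.1 - v t.2.1 ≠ 0 := sub_ne_zero.2 (hinj.ne (ne_of_lt ht))
  simp only [hf] at h
  field_simp
  linarith

lemma finite_shiIndex (n k : ℕ) : (shiIndex n k).Finite := by
  refine (Set.finite_univ.prod (Set.finite_univ.prod (Set.finite_Ioc (-(k : ℤ)) k))).subset
    fun t ht => ⟨Set.mem_univ _, Set.mem_univ _, ht.2⟩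

end Cells

/-! ### Extended coordinates and the action on alcoves -/

section Extend

variable {n : ℕ} [NeZero n] {x y z : Fin n → ℝ}

lemma extend_pos_add (x : Fin n → ℝ) (a : Fin n) (t : ℤ) :
    extend n x (pos a + t * n) = x a - t := by
  have h : extend n x (pos a + t * n) =
    x (res n (pos a + t * n)) - ((pos a + t * n - 1) / n : ℤ) := rfl
  rw [h, res_pos_add, div_pos_add]

lemma extend_pos (x : Fin n → ℝ) (a : Fin n) : extend n x (pos a) = x a := by
  simpa using extend_pos_add x a 0

lemma extend_add (x : Fin n → ℝ) (j : ℤ) : extend n x (j + n) = extend n x j - 1 := by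
  obtain ⟨a, t, rfl⟩ := exists_eq_pos_add (n := n) j
  rw [show pos a + t * n + (n : ℤ) = pos a + (t + 1) * n by ring, extend_pos_add, extend_pos_add]
  push_cast
  ring

lemma extend_add_mul (x : Fin n → ℝ) (j t : ℤ) :
    extend n x (j + t * n) = extend n x j - t := by
  rw [map_add_mul_of_map_add (f := extend n x) (c := (-1 : ℝ)) fun j => by rw [extend_add]; ring]
  simp
  ring

lemma beyond_iff_extend_lt {i j : Fin n} {l : ℤ} :
    Beyond x i j l ↔ (1 ≤ l ∧ extend n x (pos j) < extend n x (pos i + l * n)) ∨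
      (l ≤ 0 ∧ extend n x (pos i) < extend n x (pos j + -l * n)) := by
  simp only [Beyond, extend_pos_add, extend_pos]
  push_cast
  constructor <;> rintro (⟨h1, h2⟩ | ⟨h1, h2⟩) <;>
    first | exact Or.inl ⟨h1, by linarith⟩ | exact Or.inr ⟨h1, by linarith⟩

/-- Comparing two points on the `k`-Shi hyperplanes is comparing their extended coordinates at
indices of distance less than `k n`. -/
lemma beyond_imp_iff (k : ℕ) :
    (∀ t ∈ shiIndex n k, Beyond y t.1 t.2.1 t.2.2 → Beyond z t.1 t.2.1 t.2.2) ↔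
    ∀ a b : ℤ, a < b → b < a + k * n → extend n y a < extend n y b →
      extend n z a < extend n z b := by
  have hn := cast_pos_of_neZero n
  constructor
  · intro h a b hab hbk hy
    obtain ⟨i, s, rfl⟩ := exists_eq_pos_add (n := n) a
    obtain ⟨j, t, rfl⟩ := exists_eq_pos_add (n := n) b
    have hi := pos_pos i
    have hi' := pos_le i
    have hj := pos_pos j
    have hj' := pos_le j
    rw [extend_pos_add, extend_pos_add] at hy ⊢
    -- For `i < j` the bounds on `b - a` give `0 ≤ t - s < k`, hence a level `ℓ = s - t` in `(-k,
    -- 0]`; for `j < i` they give a level `ℓ = t - s` in `(0, k]`. This is the asymmetric range of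
    -- the Shi arrangement. For `i = j` the coordinates decrease, contrary to `hy`.
    rcases lt_trichotomy i j with hij | rfl | hij
    · have := pos_lt_pos.2 hij
      have h1 : s ≤ t := by nlinarith
      have h2 : t - s < k := by nlinarith
      rcases h (i, j, s - t) ⟨hij, by simp only; omega, by simp only; omega⟩
        (Or.inr ⟨by simp only; omega, by simp only; push_cast; linarith⟩) with ⟨h3, _⟩ | ⟨_, h3⟩
      · simp only at h3; omega
      · simp only at h3; push_cast at h3; linarith
    · have h1 : s < t := by nlinarith
      have h2 : (s : ℝ) < t := by exact_mod_cast h1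
      linarith
    · have := pos_lt_pos.2 hij
      have h1 : s < t := by nlinarith
      have h2 : t - s ≤ k := by nlinarith
      rcases h (j, i, t - s) ⟨hij, by simp only; omega, by simp only; omega⟩
        (Or.inl ⟨by simp only; omega, by simp only; push_cast; linarith⟩) with ⟨_, h3⟩ | ⟨h3, _⟩
      · simp only at h3; push_cast at h3; linarith
      · simp only at h3; omega
  · rintro h ⟨i, j, l⟩ ⟨hij, hl, hl'⟩ hy
    simp only at hij hl hl' hy ⊢
    rw [beyond_iff_extend_lt] at hy ⊢
    have hp := pos_lt_pos.2 hij
    have hi := pos_pos i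
    have hj' := pos_le j
    refine hy.imp (fun hy => ⟨hy.1, h _ _ ?_ ?_ hy.2⟩) (fun hy => ⟨hy.1, h _ _ ?_ ?_ hy.2⟩)
    · nlinarith
    · nlinarith
    · nlinarith [hy.1]
    · nlinarith

lemma mem_cell_shiIndex_iff {k : ℕ} (hy : Generic (shiIndex n k) y)
    (hz : Generic (shiIndex n k) z) : z ∈ cell (shiIndex n k) y ↔
    ∀ a b : ℤ, a < b → b < a + k * n → (extend n y a < extend n y b ↔
      extend n z a < extend n z b) := by
  rw [mem_cell_iff hy hz]
  have h1 := beyond_imp_iff (y := y) (z := z) k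
  have h2 := beyond_imp_iff (y := z) (z := y) k
  constructor
  · intro h a b hab hbk
    exact ⟨h1.1 (fun t ht => (h t ht).1) a b hab hbk, h2.1 (fun t ht => (h t ht).2) a b hab hbk⟩
  · intro h t ht
    exact ⟨h1.2 (fun a b hab hbk => (h a b hab hbk).1) t ht,
      h2.2 (fun a b hab hbk => (h a b hab hbk).2) t ht⟩

/-- Every braid hyperplane belongs to a `k`-Shi arrangement with `k` large, so the comparison for
Shi arrangements applies. -/
lemma beyond_imp_of_forall (h : ∀ a b : ℤ, a < b → extend n y a < extend n y b →
    extend n z a < extend n z b) {t : Fin n × Fin n × ℤ} (ht : t ∈ braidIndex n)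
    (hy : Beyond y t.1 t.2.1 t.2.2) : Beyond z t.1 t.2.1 t.2.2 :=
  (beyond_imp_iff (t.2.2.natAbs + 1)).2 (fun a b hab _ => h a b hab) t
    ⟨ht, by omega, by omega⟩ hy

lemma extend_lt_of_beyond_imp
    (h : ∀ t ∈ braidIndex n, Beyond y t.1 t.2.1 t.2.2 → Beyond z t.1 t.2.1 t.2.2) {a b : ℤ}
    (hab : a < b) (hy : extend n y a < extend n y b) : extend n z a < extend n z b := by
  refine (beyond_imp_iff (b - a + 1).natAbs).1 (fun t ht => h t ht.1) a b hab ?_ hy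
  have hn := cast_pos_of_neZero n
  have : ((b - a + 1).natAbs : ℤ) = b - a + 1 := by omega
  rw [this]
  nlinarith

lemma Generic.extend_injective (hx : Generic (braidIndex n) x) :
    Function.Injective (extend n x) := by
  intro a b hab
  obtain ⟨i, s, rfl⟩ := exists_eq_pos_add (n := n) a
  obtain ⟨j, t, rfl⟩ := exists_eq_pos_add (n := n) b
  rw [extend_pos_add, extend_pos_add] at hab
  rcases lt_trichotomy i j with hij | rfl | hij
  · refine absurd ?_ (hx.2 (i, j, s - t) hij)
    push_cast; linarith
  · have : (s : ℝ) = t := by linarith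
    rw [Int.cast_injective this]
  · refine absurd ?_ (hx.2 (j, i, t - s) hij)
    push_cast; linarith

lemma generic_of_extend_injective (hV : x ∈ V n) (hx : Function.Injective (extend n x)) :
    Generic (braidIndex n) x := by
  refine ⟨hV, fun t ht he => ?_⟩
  have h1 : extend n x (pos t.1 + 0 * n) = extend n x (pos t.2.1 + -t.2.2 * n) := by
    rw [extend_pos_add, extend_pos_add]; push_cast; linarith
  exact ne_of_lt ht (pos_add_inj (hx h1)).1

lemma mem_cell_braidIndex_iff (hy : Generic (braidIndex n) y)
    (hz : Generic (braidIndex n) z) : z ∈ cell (braidIndex n) y ↔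
    ∀ a b : ℤ, extend n y a < extend n y b ↔ extend n z a < extend n z b := by
  rw [mem_cell_iff hy hz]
  constructor
  · intro h
    have h1 : ∀ a b : ℤ, a < b → (extend n y a < extend n y b ↔ extend n z a < extend n z b) :=
      fun a b hab => ⟨extend_lt_of_beyond_imp (fun t ht => (h t ht).1) hab,
        extend_lt_of_beyond_imp (fun t ht => (h t ht).2) hab⟩
    intro a b
    rcases lt_trichotomy a b with hab | rfl | hab
    · exact h1 a b hab
    · simp
    · have h2 := h1 b a hab
      have h3 := hy.extend_injective.ne hab.ne
      have h4 := hz.extend_injective.ne hab.ne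
      rw [← not_le, ← not_le, h3.le_iff_lt, h4.le_iff_lt, h2]
  · intro h t ht
    exact ⟨beyond_imp_of_forall (fun a b _ => (h a b).1) ht,
      beyond_imp_of_forall (fun a b _ => (h a b).2) ht⟩

/-- A point whose extended coordinates are ordered like `-σ`. -/
noncomputable def point (n : ℕ) (σ : ℤ → ℤ) : Fin n → ℝ := fun a =>
  -(σ (pos a)) / n + (∑ b : Fin n, (σ (pos b) : ℝ) / n) / n

lemma point_mem_V (σ : ℤ → ℤ) : point n σ ∈ V n := by
  have hn : (n : ℝ) ≠ 0 := by exact_mod_cast NeZero.ne n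
  simp only [V, Set.mem_ofPred_eq, point, Finset.sum_add_distrib, Finset.sum_const,
    Finset.card_univ, Fintype.card_fin, nsmul_eq_mul, neg_div, Finset.sum_neg_distrib]
  field_simp
  ring

lemma extend_point {σ : ℤ → ℤ} (h : ∀ x, σ (x + n) = σ x + n) (j : ℤ) :
    extend n (point n σ) j = -(σ j) / n + (∑ b : Fin n, (σ (pos b) : ℝ) / n) / n := by
  have hn : (n : ℝ) ≠ 0 := by exact_mod_cast NeZero.ne n
  obtain ⟨a, t, rfl⟩ := exists_eq_pos_add (n := n) j
  rw [extend_pos_add, equivariant_add_mul h, point]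
  push_cast
  field_simp
  ring

lemma extend_point_lt_iff {σ : ℤ → ℤ} (h : ∀ x, σ (x + n) = σ x + n) {a b : ℤ} :
    extend n (point n σ) a < extend n (point n σ) b ↔ σ b < σ a := by
  have hn : (0 : ℝ) < n := by exact_mod_cast cast_pos_of_neZero n
  rw [extend_point h, extend_point h, add_lt_add_iff_right, div_lt_div_iff_of_pos_right hn,
    neg_lt_neg_iff, Int.cast_lt]

lemma generic_point {σ : ℤ → ℤ} (h : ∀ x, σ (x + n) = σ x + n) (hσ : Function.Injective σ) :
    Generic (braidIndex n) (point n σ) := by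
  refine generic_of_extend_injective (point_mem_V σ) fun a b hab => hσ ?_
  have h1 := (extend_point_lt_iff h (a := a) (b := b)).not.1 hab.not_lt
  have h2 := (extend_point_lt_iff h (a := b) (b := a)).not.1 hab.symm.not_lt
  omega

/-- It suffices to compare neighbours: within a period these are the inequalities `x_i > x_{i+1}`,
and the step from `n` to `n + 1` is `x_n > x_1 - 1`. -/
lemma mem_fundAlcove_iff : x ∈ fundAlcove n ↔
    x ∈ V n ∧ StrictAnti (extend n x) := by
  have hn := cast_pos_of_neZero n
  refine and_congr_right fun _ => ⟨fun h => ?_, fun h => ⟨fun i j hij => ?_, ?_⟩⟩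
  · refine strictAnti_int_of_succ_lt fun j => ?_
    obtain ⟨a, t, rfl⟩ := exists_eq_pos_add (n := n) j
    by_cases ha : (a : ℕ) + 1 < n
    · have h1 : pos a + t * n + 1 = pos (⟨a + 1, ha⟩ : Fin n) + t * n := by
        simp only [pos]; push_cast; ring
      rw [h1, extend_pos_add, extend_pos_add]
      have := h.1 a ⟨a + 1, ha⟩ (Fin.lt_def.2 (by simp))
      linarith
    · have ha' : a = Fin.rev 0 := by
        apply Fin.ext
        rw [Fin.val_rev]
        simp
        omega
      have h1 : pos a + t * n + 1 = pos (0 : Fin n) + (t + 1) * n := by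
        have : ((a : ℕ) : ℤ) + 1 = n := by omega
        simp only [pos, this]; simp; ring
      rw [h1, extend_pos_add, extend_pos_add, ha']
      push_cast
      linarith [h.2]
  · have := h (pos_lt_pos.2 hij)
    rwa [extend_pos, extend_pos] at this
  · have h1 : pos (Fin.rev (0 : Fin n)) < pos (0 : Fin n) + 1 * n := by
      have := pos_le (Fin.rev (0 : Fin n))
      have := pos_pos (0 : Fin n)
      linarith
    have := h h1
    rw [extend_pos, extend_pos_add] at this
    simpa using this

lemma fundAlcove_nonempty : (fundAlcove n).Nonempty :=
  ⟨point n id, mem_fundAlcove_iff.2 ⟨point_mem_V _, fun _ _ hab =>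
    (extend_point_lt_iff fun _ => rfl).2 hab⟩⟩

lemma sub_mem_Ioo_of_mem_fundAlcove (hx : x ∈ fundAlcove n) {i j : Fin n} (hij : i < j) :
    x i - x j ∈ Set.Ioo (0 : ℝ) 1 := by
  have h := (mem_fundAlcove_iff.1 hx).2
  have h1 := h (pos_lt_pos.2 hij)
  have h2 : pos j < pos i + 1 * n := by
    have := pos_le j
    have := pos_pos i
    linarith
  have h3 := h h2
  rw [extend_pos, extend_pos] at h1
  rw [extend_pos, extend_pos_add] at h3
  push_cast at h3
  constructor <;> linarith

/-- On `A₀` the differences `x i - x j` with `i < j` lie in `(0, 1)`, so the sign of `l - 1/2` tells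
the side of `A₀`, and one point of the cell tells the side of the cell. -/
lemma separates_cell_iff {S : Set (Fin n × Fin n × ℤ)} (hy : Generic S y) {i j : Fin n} {l : ℤ}
    (hij : i < j) (ht : (i, j, l) ∈ S) : Separates n i j l (cell S y) ↔ Beyond y i j l := by
  obtain ⟨x, hx⟩ := fundAlcove_nonempty (n := n)
  have hx1 := sub_mem_Ioo_of_mem_fundAlcove hx hij
  constructor
  · rintro (⟨h1, h2⟩ | ⟨h1, h2⟩)
    · refine Or.inl ⟨?_, h2 y hy.mem_cell⟩
      have : (0 : ℝ) < l := hx1.1.trans (h1 x hx)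
      exact Int.cast_pos.1 this
    · refine Or.inr ⟨?_, h2 y hy.mem_cell⟩
      have h : (l : ℝ) < 1 := (h1 x hx).trans hx1.2
      have : l < 1 := by exact_mod_cast h
      omega
  · rintro (⟨h1, h2⟩ | ⟨h1, h2⟩)
    · refine Or.inl ⟨fun x hx => ?_, fun z hz => ?_⟩
      · have : (1 : ℝ) ≤ l := by exact_mod_cast h1
        exact (sub_mem_Ioo_of_mem_fundAlcove hx hij).2.trans_le this
      · rcases hz.2 _ ht with h | h
        · exact absurd h.1 h2.not_gt
        · exact h.2
    · refine Or.inr ⟨fun x hx => ?_, fun z hz => ?_⟩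
      · have : (l : ℝ) ≤ 0 := by exact_mod_cast h1
        exact this.trans_lt (sub_mem_Ioo_of_mem_fundAlcove hx hij).1
      · rcases hz.2 _ ht with h | h
        · exact h.2
        · exact absurd h.1 h2.not_gt

lemma extend_act {ω : Equiv.Perm ℤ} (hω : IsAffinePerm n ω) (x : Fin n → ℝ) (j : ℤ) :
    extend n (act n ω x) j = extend n x (ω⁻¹ j) := by
  obtain ⟨a, t, rfl⟩ := exists_eq_pos_add (n := n) j
  rw [extend_pos_add, equivariant_add_mul hω.inv.1, extend_add_mul]
  rfl

/-- The function `extend n x j + j / n` of `j` is periodic, so `ω⁻¹` preserves its sum over a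
window; the normalization of `ω⁻¹` takes care of the linear term. -/
lemma act_mem_V {ω : Equiv.Perm ℤ} (hω : IsAffinePerm n ω) (hx : x ∈ V n) : act n ω x ∈ V n := by
  have hn : (n : ℝ) ≠ 0 := by exact_mod_cast NeZero.ne n
  have h1 := sum_comp_pos (n := n) (p := fun j => extend n x j + j / n)
    (fun j => by rw [extend_add]; push_cast; field_simp; ring) ω⁻¹.injective hω.inv.1
  have h2 := (isAffinePerm_iff.1 hω.inv).2
  have h3 : ∑ a : Fin n, ((ω⁻¹ (pos a) : ℤ) : ℝ) = ∑ a : Fin n, (pos a : ℝ) := by exact_mod_cast h2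
  simp only [Finset.sum_add_distrib, ← Finset.sum_div, h3, extend_pos] at h1
  have h4 : ∑ a, x a = 0 := hx
  simp only [V, Set.mem_ofPred_eq, act]
  linarith

/-- The action permutes the extended coordinates, and those of a point of `A₀` are strictly
decreasing. -/
lemma mem_alcove_iff {ω : Equiv.Perm ℤ} (hω : IsAffinePerm n ω) : z ∈ alcove n ω ↔
    z ∈ V n ∧ ∀ a b, extend n z a < extend n z b ↔ ω⁻¹ b < ω⁻¹ a := by
  constructor
  · rintro ⟨x, hx, rfl⟩
    obtain ⟨hV, ha⟩ := mem_fundAlcove_iff.1 hx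
    exact ⟨act_mem_V hω hV, fun a b => by rw [extend_act hω, extend_act hω, ha.lt_iff_gt]⟩
  · rintro ⟨hV, h⟩
    have hinv : ∀ x : Fin n → ℝ, act n ω (act n ω⁻¹ x) = x := fun x => by
      ext a
      have := extend_act hω.inv x (ω⁻¹ (pos a))
      rw [inv_inv, perm_apply_inv, extend_pos] at this
      exact this
    refine ⟨act n ω⁻¹ z, mem_fundAlcove_iff.2 ⟨act_mem_V hω.inv hV, fun a b hab => ?_⟩, hinv z⟩
    rw [extend_act hω.inv, extend_act hω.inv, inv_inv, h, perm_inv_apply, perm_inv_apply]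
    exact hab

lemma point_mem_alcove {ω : Equiv.Perm ℤ} (hω : IsAffinePerm n ω) :
    point n (ω⁻¹ : Equiv.Perm ℤ) ∈ alcove n ω :=
  (mem_alcove_iff hω).2 ⟨point_mem_V _, fun _ _ => extend_point_lt_iff hω.inv.1⟩

lemma generic_point_inv {ω : Equiv.Perm ℤ} (hω : IsAffinePerm n ω) :
    Generic (braidIndex n) (point n (ω⁻¹ : Equiv.Perm ℤ)) :=
  generic_point hω.inv.1 ω⁻¹.injective

lemma alcove_eq_cell {ω : Equiv.Perm ℤ} (hω : IsAffinePerm n ω) :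
    alcove n ω = cell (braidIndex n) (point n (ω⁻¹ : Equiv.Perm ℤ)) := by
  have hp := generic_point_inv hω
  ext z
  rw [mem_alcove_iff hω]
  constructor
  · rintro ⟨hV, h⟩
    refine (mem_cell_braidIndex_iff hp (generic_of_extend_injective hV fun a b hab => ?_)).2
      fun a b => by rw [h, extend_point_lt_iff hω.inv.1]
    have h1 := (h a b).not.1 hab.not_lt
    have h2 := (h b a).not.1 hab.symm.not_lt
    exact ω⁻¹.injective (by omega)
  · intro hz
    refine ⟨hz.1, fun a b => ?_⟩
    rw [← (mem_cell_braidIndex_iff hp (generic_of_mem_cell hz)).1 hz,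
      extend_point_lt_iff hω.inv.1]

/-- Every generic point lies in some `ω(A₀)`. -/
lemma exists_mem_alcove (hy : Generic (braidIndex n) y) :
    ∃ ω, IsAffinePerm n ω ∧ y ∈ alcove n ω := by
  obtain ⟨ρ, hρ, ho⟩ := exists_rank (n := n) (h := fun j => -extend n y j)
    (neg_injective.comp hy.extend_injective) one_pos fun j => by rw [extend_add]; ring
  -- The rank is determined up to a translation; subtracting `e` normalizes the sum.
  obtain ⟨e, he⟩ := dvd_sum_sub_sum_pos ρ.injective hρ
  set σ : Equiv.Perm ℤ := ρ.trans (Equiv.subRight e) with hσ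
  have hσ' : ∀ x, σ x = ρ x - e := fun x => rfl
  have haff : IsAffinePerm n σ := by
    refine isAffinePerm_iff.2 ⟨fun x => by rw [hσ', hσ', hρ]; ring, ?_⟩
    simp only [hσ', Finset.sum_sub_distrib, Finset.sum_const, Finset.card_univ,
      Fintype.card_fin, nsmul_eq_mul]
    linarith
  refine ⟨σ⁻¹, haff.inv, (mem_alcove_iff haff.inv).2 ⟨hy.1, fun a b => ?_⟩⟩
  rw [inv_inv, hσ', hσ', sub_lt_sub_iff_right, ho, neg_lt_neg_iff]

end Extend

/-! ### Inversions of stable permutations and exchanges of adjacent positions -/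

section Exchange

variable {n k : ℕ} {ω : Equiv.Perm ℤ}

lemma lt_add_of_mem_stablePerms (h : ω ∈ stablePerms n (k * n + 1)) (x : ℤ) :
    ω x < ω (x + 1) + k * n := by
  have h1 := h.2 x
  rw [← equivariant_add_mul h.1.1]
  convert h1 using 2
  push_cast
  ring

/-- For a stable permutation the inversions are implied by the relative order of the pairs of
values of distance less than `k n`. -/
lemma lt_of_inversion (hω : ∀ x, ω x < ω (x + 1) + k * n) {z : ℤ → ℝ}
    (hz : ∀ a b : ℤ, a < b → b < a + k * n → ω⁻¹ b < ω⁻¹ a → z a < z b) {a b : ℤ} (hab : a < b)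
    (hinv : ω⁻¹ b < ω⁻¹ a) : z a < z b := by
  suffices H : ∀ d : ℕ, ∀ p q : ℤ, p < q → q - p ≤ d → ω q < ω p → z (ω q) < z (ω p) by
    have := H (ω⁻¹ a - ω⁻¹ b).toNat _ _ hinv (by omega)
      (by rwa [perm_apply_inv, perm_apply_inv])
    rwa [perm_apply_inv, perm_apply_inv] at this
  have hz' : ∀ p q : ℤ, p < q → ω q < ω p → ω p < ω q + k * n → z (ω q) < z (ω p) :=
    fun p q h1 h2 h3 => hz _ _ h2 h3 (by rwa [perm_inv_apply, perm_inv_apply])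
  intro d
  induction d with
  | zero => intro p q h1 h2; omega
  | succ d ih =>
    intro p q hpq hd hlt
    -- Let `r` be the first position after `p` with a value below `ω p`. The value at `r - 1` is at
    -- least `ω p`, so stability bounds the drop from `ω p` to `ω r` by `k n`. Either the drop to `ω
    -- q` is no larger, or `(r, q)` is a shorter inversion to be chained with `(p, r)`.
    obtain ⟨r, ⟨hpr, hr⟩, hmin⟩ := Int.exists_least_of_bdd (P := fun r => p < r ∧ ω r < ω p)
      ⟨p, fun r hr => hr.1.le⟩ ⟨q, hpq, hlt⟩
    have hrq : r ≤ q := hmin q ⟨hpq, hlt⟩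
    have h1 : ω p ≤ ω (r - 1) := by
      by_contra hc
      have hne : r - 1 ≠ p := by rintro h; rw [h] at hc; exact hc le_rfl
      have := hmin (r - 1) ⟨by omega, not_le.1 hc⟩
      omega
    have h2 := hω (r - 1)
    rw [sub_add_cancel] at h2
    have h3 : ω p < ω r + k * n := h1.trans_lt h2
    rcases le_or_gt (ω r) (ω q) with h | h
    · exact hz' p q hpq hlt (by linarith)
    · have hrq' : r ≠ q := by rintro rfl; exact lt_irrefl _ h
      exact (ih r q (by omega) (by omega) h).trans (hz' p r hpr hr h3)

lemma finite_beyond (y : Fin n → ℝ) :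
    {t : Fin n × Fin n × ℤ | t.1 < t.2.1 ∧ Beyond y t.1 t.2.1 t.2.2}.Finite := by
  refine (Set.finite_iUnion fun i => Set.finite_iUnion fun j =>
    (Set.finite_Icc (-⌈|y i - y j|⌉) ⌈|y i - y j|⌉).image
      fun l => ((i, j, l) : Fin n × Fin n × ℤ)).subset ?_
  rintro ⟨i, j, l⟩ ⟨-, h⟩
  simp only [Set.mem_iUnion]
  refine ⟨i, j, l, ?_, rfl⟩
  have h1 := Int.le_ceil |y i - y j|
  have h2 := le_abs_self (y i - y j)
  have h3 := neg_abs_le (y i - y j)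
  have h4 : (0 : ℝ) ≤ ⌈|y i - y j|⌉ := (abs_nonneg _).trans h1
  rcases h with ⟨h5, h⟩ | ⟨h5, h⟩ <;> simp only at h h5
  · have h6 : (1 : ℝ) ≤ l := by exact_mod_cast h5
    constructor
    · have : (-⌈|y i - y j|⌉ : ℝ) ≤ l := by linarith
      exact_mod_cast this
    · have : (l : ℝ) ≤ ⌈|y i - y j|⌉ := by linarith
      exact_mod_cast this
  · have h6 : (l : ℝ) ≤ 0 := by exact_mod_cast h5
    constructor
    · have : (-⌈|y i - y j|⌉ : ℝ) ≤ l := by linarith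
      exact_mod_cast this
    · have : (l : ℝ) ≤ ⌈|y i - y j|⌉ := by linarith
      exact_mod_cast this

lemma cell_subset_cell {S T : Set (Fin n × Fin n × ℤ)} (h : T ⊆ S) (x : Fin n → ℝ) :
    cell S x ⊆ cell T x := fun _ hz => ⟨hz.1, fun t ht => hz.2 t (h ht)⟩

/-- The exchange of the positions congruent to `x` and `x + 1` modulo `n`. -/
def exchange (n : ℕ) (x u : ℤ) : ℤ :=
  if (n : ℤ) ∣ u - x then u + 1 else if (n : ℤ) ∣ u - x - 1 then u - 1 else u

lemma exchange_add (x u : ℤ) : exchange n x (u + n) = exchange n x u + n := by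
  have h1 : (n : ℤ) ∣ u + n - x ↔ (n : ℤ) ∣ u - x := by
    rw [show u + n - x = u - x + n by ring, dvd_add_self_right]
  have h2 : (n : ℤ) ∣ u + n - x - 1 ↔ (n : ℤ) ∣ u - x - 1 := by
    rw [show u + n - x - 1 = u - x - 1 + n by ring, dvd_add_self_right]
  unfold exchange
  simp only [h1, h2]
  split_ifs <;> ring

lemma exchange_exchange (hn : n ≠ 1) (x u : ℤ) : exchange n x (exchange n x u) = u := by
  have hn1 : ¬ (n : ℤ) ∣ 1 := fun h => hn (by exact_mod_cast Int.eq_one_of_dvd_one (by omega) h)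
  unfold exchange
  by_cases h : (n : ℤ) ∣ u - x
  · have h1 : ¬ (n : ℤ) ∣ u + 1 - x := fun h' => hn1 (by
      simpa using dvd_sub h' h)
    have h2 : (n : ℤ) ∣ u + 1 - x - 1 := by convert h using 1; ring
    simp [h, h1, h2]
  · by_cases h' : (n : ℤ) ∣ u - x - 1
    · have h1 : (n : ℤ) ∣ u - 1 - x := by convert h' using 1; ring
      simp [h, h', h1]
    · simp [h, h']

/-- The exchange reverses only the order of adjacent positions `x + t n`, `x + 1 + t n`. -/
lemma exchange_lt_exchange {x u v : ℤ} (huv : u < v) (h : ¬ ((n : ℤ) ∣ u - x ∧ v = u + 1))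
    (hn : n ≠ 1) : exchange n x u < exchange n x v := by
  have h1 : exchange n x u ≤ exchange n x v := by
    unfold exchange
    by_cases hux : (n : ℤ) ∣ u - x <;> by_cases hvx : (n : ℤ) ∣ v - x <;>
      by_cases hux' : (n : ℤ) ∣ u - x - 1 <;> by_cases hvx' : (n : ℤ) ∣ v - x - 1 <;>
      simp only [hux, hvx, hux', hvx', if_true, if_false] <;> simp only [hux, true_and] at h <;>
      omega
  refine h1.lt_of_ne fun he => ?_
  have := congrArg (exchange n x) he
  rw [exchange_exchange hn, exchange_exchange hn] at this
  omega

end Exchange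

/-! ### Minimal alcoves of Shi regions and their labels -/

section Minimal

variable {n : ℕ} [NeZero n] {k : ℕ} {ω : Equiv.Perm ℤ}

lemma numSeparating_cell {y : Fin n → ℝ} (hy : Generic (braidIndex n) y) :
    numSeparating n (cell (braidIndex n) y) =
      {t : Fin n × Fin n × ℤ | t.1 < t.2.1 ∧ Beyond y t.1 t.2.1 t.2.2}.ncard := by
  unfold numSeparating
  congr 1
  ext ⟨i, j, l⟩
  exact and_congr_right fun hij => separates_cell_iff hy hij hij

/-- If the inversions of `y` are inversions of `z`, then the number of separating hyperplanes
increases strictly from the alcove of `y` to that of `z`, unless the alcoves agree. -/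
lemma numSeparating_lt {y z : Fin n → ℝ} (hy : Generic (braidIndex n) y)
    (hz : Generic (braidIndex n) z)
    (h : ∀ a b : ℤ, a < b → extend n y a < extend n y b → extend n z a < extend n z b)
    (hne : cell (braidIndex n) z ≠ cell (braidIndex n) y) :
    numSeparating n (cell (braidIndex n) y) < numSeparating n (cell (braidIndex n) z) := by
  rw [numSeparating_cell hy, numSeparating_cell hz]
  refine Set.ncard_lt_ncard ⟨fun t ht => ⟨ht.1, beyond_imp_of_forall h ht.1 ht.2⟩,
    fun hsub => hne (cell_eq_of_mem ?_)⟩ (finite_beyond z)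
  exact (mem_cell_iff hy hz).2 fun t ht =>
    ⟨beyond_imp_of_forall h ht, fun hb => (hsub ⟨ht, hb⟩).2⟩

/-- An alcove of the region shares the inversions of height less than `k n` with `ω`, and these
force all the others; so every hyperplane that separates `ω(A₀)` from `A₀` also separates that
alcove from `A₀`. -/
lemma isMinimalAlcove_cell (h : ω ∈ stablePerms n (k * n + 1)) :
    IsMinimalAlcove n (cell (shiIndex n k) (point n (ω⁻¹ : Equiv.Perm ℤ))) (alcove n ω) := by
  have hω := h.1
  have hp := generic_point_inv hω
  have hps := hp.mono (shiIndex_subset n k)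
  rw [alcove_eq_cell hω]
  refine ⟨mem_alcoves_iff.2 ⟨_, hp, rfl⟩, cell_subset_cell (shiIndex_subset n k) _, ?_⟩
  intro B hB hBR hne
  obtain ⟨y, hy, rfl⟩ := mem_alcoves_iff.1 hB
  refine numSeparating_lt hp hy (fun a b hab hlt => ?_) hne
  have hyR := (mem_cell_shiIndex_iff hps (hy.mono (shiIndex_subset n k))).1 (hBR hy.mem_cell)
  simp only [extend_point_lt_iff hω.inv.1] at hyR hlt
  exact lt_of_inversion (lt_add_of_mem_stablePerms h) (fun a b hab hbk hi =>
    (hyR a b hab hbk).1 hi) hab hlt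

lemma alc_eq (h : ω ∈ stablePerms n (k * n + 1)) :
    alc n k ω = cell (shiIndex n k) (point n (ω⁻¹ : Equiv.Perm ℤ)) := by
  have hps := (generic_point_inv h.1).mono (shiIndex_subset n k)
  have hset : {R | R ∈ shiRegions n k ∧ IsMinimalAlcove n R (alcove n ω)} =
      {cell (shiIndex n k) (point n (ω⁻¹ : Equiv.Perm ℤ))} := by
    ext R
    constructor
    · rintro ⟨hR, hm⟩
      obtain ⟨x, hx, rfl⟩ := mem_shiRegions_iff.1 hR
      exact (cell_eq_of_mem (hm.2.1 (point_mem_alcove h.1))).symm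
    · rintro rfl
      exact ⟨mem_shiRegions_iff.2 ⟨_, hps, rfl⟩, isMinimalAlcove_cell h⟩
  rw [alc, hset, Set.sUnion_singleton]

lemma alc_mem_shiRegions (h : ω ∈ stablePerms n (k * n + 1)) : alc n k ω ∈ shiRegions n k := by
  rw [alc_eq h]
  exact mem_shiRegions_iff.2 ⟨_, (generic_point_inv h.1).mono (shiIndex_subset n k), rfl⟩

lemma isMinimalAlcove_alc (h : ω ∈ stablePerms n (k * n + 1)) :
    IsMinimalAlcove n (alc n k ω) (alcove n ω) := by
  rw [alc_eq h]
  exact isMinimalAlcove_cell h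

lemma IsMinimalAlcove.unique {R A B : Set (Fin n → ℝ)} (hA : IsMinimalAlcove n R A)
    (hB : IsMinimalAlcove n R B) : A = B := by
  by_contra hne
  exact (hA.2.2 B hB.1 hB.2.1 (Ne.symm hne)).asymm (hB.2.2 A hA.1 hA.2.1 hne)

lemma eq_of_alcove_eq {ω' : Equiv.Perm ℤ} (h : IsAffinePerm n ω) (h' : IsAffinePerm n ω')
    (he : alcove n ω = alcove n ω') : ω = ω' := by
  have h1 := point_mem_alcove h
  rw [he] at h1
  refine eq_of_order h h' fun a b => ?_
  rw [← ((mem_alcove_iff h').1 h1).2 b a, extend_point_lt_iff h.inv.1]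

lemma injOn_alc : Set.InjOn (alc n k) (stablePerms n (k * n + 1)) := fun _ h _ h' he =>
  eq_of_alcove_eq h.1 h'.1 ((isMinimalAlcove_alc h).unique (he ▸ isMinimalAlcove_alc h'))

/-- An alcove of a `k`-Shi region with the least number of separating hyperplanes comes from a
stable permutation. -/
lemma mem_stablePerms_of_minimal (hω : IsAffinePerm n ω) {R : Set (Fin n → ℝ)}
    (hR : R ∈ shiRegions n k) (hsub : point n (ω⁻¹ : Equiv.Perm ℤ) ∈ R)
    (hmin : ∀ z, Generic (braidIndex n) z → z ∈ R →
      numSeparating n (alcove n ω) ≤ numSeparating n (cell (braidIndex n) z)) :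
    ω ∈ stablePerms n (k * n + 1) := by
  refine ⟨hω, fun x => ?_⟩
  have hkn : ω (x + ((k * n + 1 : ℕ) : ℤ)) = ω (x + 1) + k * n := by
    rw [← equivariant_add_mul hω.1]
    congr 1
    push_cast
    ring
  rw [hkn]
  -- For `n = 1` the positions `x` and `x + 1` are congruent and cannot be exchanged, but stability
  -- is automatic.
  by_cases hn : n = 1
  · have h1 := hω.1 x
    rw [hn] at h1 ⊢
    push_cast at h1 ⊢
    rw [h1]
    linarith [Int.natCast_nonneg k]
  by_contra hlt
  have hge : ω (x + 1) + k * n ≤ ω x := not_lt.1 hlt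
  obtain ⟨x₀, hx₀, rfl⟩ := mem_shiRegions_iff.1 hR
  set y := point n (ω⁻¹ : Equiv.Perm ℤ) with hy_def
  have hy := generic_point_inv hω
  have hys := hy.mono (shiIndex_subset n k)
  set σ : ℤ → ℤ := fun j => exchange n x (ω⁻¹ j) with hσ
  have hσn : ∀ j, σ (j + n) = σ j + n := fun j => by simp only [hσ, hω.inv.1, exchange_add]
  have hinj : Function.Injective (exchange n x) :=
    (Function.LeftInverse.injective (exchange_exchange hn x))
  have hσi : Function.Injective σ := hinj.comp ω⁻¹.injective
  set z := point n σ with hz_def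
  have hz := generic_point hσn hσi
  have hzs := hz.mono (shiIndex_subset n k)
  -- All exchanged pairs have the same drop of values, which is at least `k n`. Hence the exchange
  -- keeps the order of every pair that the Shi arrangement compares and creates no inversion.
  have hpos : ∀ u, (n : ℤ) ∣ u - x → ω (u + 1) - ω u = ω (x + 1) - ω x := by
    rintro u ⟨c, hc⟩
    rw [show u = x + c * n by linarith, show x + c * n + 1 = x + 1 + c * n by ring,
      equivariant_add_mul hω.1, equivariant_add_mul hω.1]
    ring
  have hkn0 : (0 : ℤ) ≤ k * n := by positivity
  have hlt1 : ω (x + 1) < ω x := lt_of_le_of_ne (by linarith)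
    (ω.injective.ne (by omega))
  have hback : ∀ a b : ℤ, a < b → ω⁻¹ a < ω⁻¹ b → σ a < σ b := fun a b hab hlt => by
    refine exchange_lt_exchange hlt ?_ hn
    rintro ⟨hd, he⟩
    have := hpos _ hd
    rw [← he, perm_apply_inv, perm_apply_inv] at this
    omega
  have hfwd : ∀ a b : ℤ, a < b → b < a + k * n → ω⁻¹ b < ω⁻¹ a → σ b < σ a :=
    fun a b hab hbk hlt => by
    refine exchange_lt_exchange hlt ?_ hn
    rintro ⟨hd, he⟩
    have := hpos _ hd
    rw [← he, perm_apply_inv, perm_apply_inv] at this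
    omega
  have hzy : ∀ a b : ℤ, a < b → extend n z a < extend n z b → extend n y a < extend n y b := by
    intro a b hab h
    rw [extend_point_lt_iff hσn] at h
    rw [extend_point_lt_iff hω.inv.1]
    by_contra hc
    have hne : ω⁻¹ a ≠ ω⁻¹ b := ω⁻¹.injective.ne hab.ne
    exact (hback a b hab (by omega)).asymm h
  have hzc : z ∈ cell (shiIndex n k) y := by
    refine (mem_cell_shiIndex_iff hys hzs).2 fun a b hab hbk => ⟨fun h => ?_, hzy a b hab⟩
    rw [extend_point_lt_iff hσn]
    rw [extend_point_lt_iff hω.inv.1] at h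
    exact hfwd a b hab hbk h
  rw [cell_eq_of_mem hsub] at hzc
  refine (numSeparating_lt hz hy hzy fun he => ?_).not_ge (alcove_eq_cell hω ▸ hmin z hz hzc)
  -- The alcove has changed, because the pair `ω (x + 1) < ω x` is no longer inverted.
  have hmem : z ∈ cell (braidIndex n) y := he ▸ hz.mem_cell
  have h1 := ((mem_cell_braidIndex_iff hy hz).1 hmem (ω (x + 1)) (ω x)).1
    ((extend_point_lt_iff hω.inv.1).2 (by
      rw [perm_inv_apply, perm_inv_apply]; omega))
  rw [extend_point_lt_iff hσn] at h1
  simp only [hσ, perm_inv_apply] at h1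
  have h2 : exchange n x x = x + 1 := by simp [exchange]
  have h3 : exchange n x (x + 1) = x := by rw [← h2, exchange_exchange hn]
  omega

/-- The region contains an alcove because the arrangement is finite. One with the fewest separating
hyperplanes is some `ω(A₀)`, and the exchange argument makes `ω` stable. -/
lemma surjOn_alc : Set.SurjOn (alc n k) (stablePerms n (k * n + 1)) (shiRegions n k) := by
  intro R hR
  obtain ⟨x, hx, rfl⟩ := mem_shiRegions_iff.1 hR
  obtain ⟨y₀, hy₀, hy₀g⟩ := exists_generic_mem_cell (finite_shiIndex n k) hx
  obtain ⟨y, ⟨hyg, hyR⟩, hmin⟩ := WellFounded.has_min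
    (InvImage.wf (fun y => numSeparating n (cell (braidIndex n) y)) wellFounded_lt)
    {y | Generic (braidIndex n) y ∧ y ∈ cell (shiIndex n k) x} ⟨y₀, hy₀g, hy₀⟩
  obtain ⟨ω, hω, hyω⟩ := exists_mem_alcove hyg
  have hcell : cell (braidIndex n) y = alcove n ω := by
    rw [alcove_eq_cell hω] at hyω ⊢
    exact cell_eq_of_mem hyω
  have hpR : point n (ω⁻¹ : Equiv.Perm ℤ) ∈ cell (shiIndex n k) x := by
    have h1 : point n (ω⁻¹ : Equiv.Perm ℤ) ∈ cell (braidIndex n) y :=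
      hcell ▸ point_mem_alcove hω
    rw [← cell_eq_of_mem hyR]
    exact cell_subset_cell (shiIndex_subset n k) y h1
  have hst : ω ∈ stablePerms n (k * n + 1) :=
    mem_stablePerms_of_minimal hω hR hpR fun z hz hzR =>
      hcell ▸ not_lt.1 (hmin z ⟨hz, hzR⟩)
  exact ⟨ω, hst, by rw [alc_eq hst, cell_eq_of_mem hpR]⟩

lemma bijOn_alc : Set.BijOn (alc n k) (stablePerms n (k * n + 1)) (shiRegions n k) :=
  ⟨fun _ h => alc_mem_shiRegions h, injOn_alc, surjOn_alc⟩

/-- In every residue class, as many inversions of `a` have a small difference of values as have a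
small difference of positions. -/
lemma pakStanley_alc (h : ω ∈ stablePerms n (k * n + 1)) :
    pakStanley n k (alc n k ω) = PS n (k * n + 1) ω := by
  have hn := cast_pos_of_neZero n
  have hω := h.1
  have hps := (generic_point_inv hω).mono (shiIndex_subset n k)
  ext a
  rw [alc_eq h]
  set σ : ℤ → ℤ := fun j => ω⁻¹ j with hσ
  have hσn : ∀ j t, σ (j + t * n) = σ j + t * n := equivariant_add_mul hω.inv.1
  -- The inversions of `pos a` in the class of `b` are the `pos b + s * n` with `L b ≤ s ≤ U b`: the
  -- lower bound makes the value larger, the upper bound the position smaller.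
  set L : Fin n → ℤ := fun b => if a < b then 0 else 1 with hL
  set U : Fin n → ℤ := fun b => (σ (pos a) - σ (pos b) - 1) / n with hU
  have hLs : ∀ b s, pos a < pos b + s * n ↔ L b ≤ s := fun b s => by
    have h1 := pos_pos a
    have h2 := pos_le a
    have h3 := pos_pos b
    have h4 := pos_le b
    simp only [hL]
    split_ifs with hab
    · have := pos_lt_pos.2 hab
      constructor <;> intro <;> nlinarith
    · have : ¬ pos a < pos b := fun h => hab (pos_lt_pos.1 h)
      constructor <;> intro <;> nlinarith
  have hUs : ∀ b s, σ (pos b) + s * n < σ (pos a) ↔ s ≤ U b := fun b s => by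
    simp only [hU]
    rw [Int.le_ediv_iff_mul_le hn]
    omega
  -- The first `k` inversions of each class, those visible to the Shi arrangement: for `b > a` the
  -- level is `-s` and `L b = 0`, for `b < a` it is `s` and `L b = 1`.
  set T : Set (Fin n × ℤ) := {t | L t.1 ≤ t.2 ∧ t.2 ≤ U t.1 ∧ t.2 < L t.1 + k} with hT
  have hne : ∀ t ∈ T, t.1 ≠ a := by
    rintro ⟨b, s⟩ ⟨h1, h2, -⟩ rfl
    have h3 := (hUs b s).2 h2
    have h4 := (hLs b s).2 h1
    simp only at h3 h4
    omega
  set S₁ : Set (Fin n × ℤ) :=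
    {t | a < t.1 ∧ -(k : ℤ) < t.2 ∧ t.2 ≤ 0 ∧
      Separates n a t.1 t.2 (cell (shiIndex n k) (point n σ))} with hS₁
  set S₂ : Set (Fin n × ℤ) :=
    {t | t.1 < a ∧ 0 < t.2 ∧ t.2 ≤ k ∧
      Separates n t.1 a t.2 (cell (shiIndex n k) (point n σ))} with hS₂
  have hS₁' : S₁.Finite := ((Set.finite_univ).prod (Set.finite_Ioc (-(k : ℤ)) 0)).subset
    fun t ht => ⟨Set.mem_univ _, ht.2.1, ht.2.2.1⟩
  have hS₂' : S₂.Finite := ((Set.finite_univ).prod (Set.finite_Ioc 0 (k : ℤ))).subset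
    fun t ht => ⟨Set.mem_univ _, ht.2.1, ht.2.2.1⟩
  set neg : Fin n × ℤ → Fin n × ℤ := fun t => (t.1, -t.2) with hneg
  have hnegi : Function.Injective neg := fun t t' he => by
    simp only [hneg, Prod.mk.injEq, neg_inj] at he
    exact Prod.ext he.1 he.2
  have hTu : T = neg '' S₁ ∪ S₂ := by
    have hsep₁ : ∀ (b : Fin n) (s : ℤ), a < b → 0 ≤ s → s < k →
        (Separates n a b (-s) (cell (shiIndex n k) (point n σ)) ↔ s ≤ U b) :=
      fun b s hab h0 hk => by
        rw [separates_cell_iff hps hab ⟨hab, by simp only; omega, by simp only; omega⟩,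
          beyond_iff_extend_lt, extend_point_lt_iff hω.inv.1, extend_point_lt_iff hω.inv.1,
          neg_neg, ← hUs, ← hσn]
        simp only [hσ]
        omega
    have hsep₂ : ∀ (b : Fin n) (s : ℤ), b < a → 0 < s → s ≤ k →
        (Separates n b a s (cell (shiIndex n k) (point n σ)) ↔ s ≤ U b) :=
      fun b s hab h0 hk => by
        rw [separates_cell_iff hps hab ⟨hab, by simp only; omega, by simp only; omega⟩,
          beyond_iff_extend_lt, extend_point_lt_iff hω.inv.1, extend_point_lt_iff hω.inv.1,
          ← hUs, ← hσn]
        simp only [hσ]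
        omega
    ext ⟨b, s⟩
    constructor
    · intro ht
      have hba := hne _ ht
      obtain ⟨h1, h2, h3⟩ := ht
      simp only at h1 h2 h3 hba
      rcases lt_or_gt_of_ne hba with hab | hab
      · have hLb : L b = 1 := by simp [hL, hab.not_gt]
        rw [hLb] at h1 h3
        exact Or.inr ⟨hab, by simp only; omega, by simp only; omega,
          (hsep₂ b s hab (by omega) (by omega)).2 h2⟩
      · have hLb : L b = 0 := by simp [hL, hab]
        rw [hLb] at h1 h3
        refine Or.inl ⟨(b, -s), ⟨hab, by simp only; omega, by simp only; omega,
          (hsep₁ b s hab (by omega) (by omega)).2 h2⟩, by simp [hneg]⟩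
    · rintro (⟨⟨b', s'⟩, ⟨hab, h1, h2, h3⟩, he⟩ | ⟨hab, h1, h2, h3⟩)
      · simp only [hneg, Prod.mk.injEq] at he
        obtain ⟨rfl, rfl⟩ := he
        simp only at hab h1 h2 h3
        have hLb : L b' = 0 := by simp [hL, hab]
        have := (hsep₁ b' (-s') hab (by omega) (by omega)).1 (by rwa [neg_neg])
        exact ⟨by simp only; omega, this, by simp only; omega⟩
      · simp only at hab h1 h2 h3
        have hLb : L b = 1 := by simp [hL, hab.not_gt]
        exact ⟨by simp only; omega, (hsep₂ b s hab h1 h2).1 h3, by simp only; omega⟩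
  have hcard : pakStanley n k (cell (shiIndex n k) (point n σ)) a = T.ncard := by
    rw [hTu, Set.ncard_union_eq ?_ (hS₁'.image _) hS₂', Set.ncard_image_of_injective _ hnegi]
    · rfl
    · rw [Set.disjoint_left]
      rintro _ ⟨⟨b, s⟩, hb, rfl⟩ hb'
      exact (show a < b from hb.1).asymm hb'.1
  rw [hcard]
  -- The reflection `s ↦ L + U - s` turns `s < L + k` into `s > U - k`, which says that the
  -- positions differ by at most `k n`, that is, by less than `m`.
  set f : Fin n × ℤ → ℤ := fun t => pos t.1 + (L t.1 + U t.1 - t.2) * n with hf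
  have hfi : Function.Injective f := fun t t' he => by
    obtain ⟨h1, h2⟩ := pos_add_inj he
    rw [h1] at h2
    exact Prod.ext h1 (by omega)
  rw [← Set.ncard_image_of_injective T hfi, PS]
  congr 1
  ext β
  constructor
  · rintro ⟨⟨b, s⟩, ⟨h1, h2, h3⟩, rfl⟩
    simp only at h1 h2 h3
    simp only [hf, Set.mem_ofPred_eq]
    have h4 := (hLs b (L b + U b - s)).2 (by omega)
    have h5 := (hUs b (L b + U b - s)).2 (by omega)
    have h6 := (hUs b (L b + U b - s + k)).not.2 (by omega)
    rw [add_mul] at h6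
    have h7 := hσn (pos b) (L b + U b - s)
    simp only [hσ] at h5 h6 h7
    push_cast
    refine ⟨h4, ?_, ?_⟩ <;> rw [h7] <;> omega
  · rintro ⟨h1, h2, h3⟩
    obtain ⟨b, s, rfl⟩ := exists_eq_pos_add (n := n) β
    have h7 := hσn (pos b) s
    simp only [hσ] at h7
    rw [h7] at h2 h3
    push_cast at h3
    have h4 := (hLs b s).1 h1
    have h5 := (hUs b s).1 (by simp only [hσ]; omega)
    have h6 := (hUs b (s + k)).not.1 (by simp only [hσ]; rw [add_mul]; omega)
    refine ⟨(b, L b + U b - s), ⟨by simp only; omega, by simp only; omega, by simp only; omega⟩, ?_⟩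
    simp only [hf]
    ring

end Minimal

/-! ### Parking functions and their number -/

section Parking

variable {n m k : ℕ}

/-- Outside a nonempty set `I` of indices there is room for at most `k` inversions per index: some
member of `I` has a small label. -/
lemma exists_PS_le [NeZero n] {ω : Equiv.Perm ℤ} (hω : ∀ x, ω (x + n) = ω x + n)
    {I : Finset (Fin n)} (hI : I.Nonempty) :
    ∃ a ∈ I, PS n (k * n + 1) ω a ≤ k * (n - I.card) := by
  have hn := cast_pos_of_neZero n
  have hσn : ∀ j t, ω⁻¹ (j + t * n) = ω⁻¹ j + t * n :=
    equivariant_add_mul (equivariant_inv hω)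
  -- Take the member of `I` in the leftmost position. A position further left in a class from `I`
  -- belongs to a value `pos b + s * n` with `s < 0`, which is not above `pos a`; so the inversions
  -- counted lie in classes outside `I`, at most `k` in each.
  obtain ⟨a, ha, hmin⟩ := I.exists_min_image (fun b => ω⁻¹ (pos b)) hI
  refine ⟨a, ha, ?_⟩
  have hcard : k * (n - I.card) =
      ((Iᶜ ×ˢ Finset.Ico (0 : ℤ) k : Finset (Fin n × ℤ)) : Set (Fin n × ℤ)).ncard := by
    rw [Set.ncard_coe_finset, Finset.card_product, Finset.card_compl, Int.card_Ico,
      Fintype.card_fin, mul_comm]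
    simp
  rw [hcard, PS]
  refine Set.ncard_le_ncard_of_injOn
    (fun β => (res n β, (ω⁻¹ (pos a) - ω⁻¹ β - 1) / n)) ?_ ?_ (Finset.finite_toSet _)
  · rintro β ⟨h1, h2, h3⟩
    obtain ⟨b, s, rfl⟩ := exists_eq_pos_add (n := n) β
    simp only [Finset.coe_product, Set.mem_prod, Finset.mem_coe, Finset.mem_compl, res_pos_add,
      Finset.mem_Ico]
    refine ⟨fun hb => ?_, Int.ediv_nonneg (by omega) hn.le,
      Int.ediv_lt_of_lt_mul hn (by push_cast at h3; omega)⟩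
    have h4 := hmin b hb
    rw [hσn] at h2
    have h5 : s < 0 := by
      by_contra hs
      have := mul_nonneg (not_lt.1 hs) hn.le
      omega
    have h6 := pos_pos a
    have h7 := pos_le b
    nlinarith
  · rintro β hβ γ hγ he
    obtain ⟨b, s, rfl⟩ := exists_eq_pos_add (n := n) β
    obtain ⟨c, t, rfl⟩ := exists_eq_pos_add (n := n) γ
    simp only [res_pos_add, hσn, Prod.mk.injEq] at he
    obtain ⟨rfl, he⟩ := he
    rw [show ω⁻¹ (pos a) - (ω⁻¹ (pos b) + s * n) - 1 = ω⁻¹ (pos a) - ω⁻¹ (pos b) - 1 + -s * n by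
      ring, show ω⁻¹ (pos a) - (ω⁻¹ (pos b) + t * n) - 1 =
      ω⁻¹ (pos a) - ω⁻¹ (pos b) - 1 + -t * n by ring, Int.add_mul_ediv_right _ _ hn.ne',
      Int.add_mul_ediv_right _ _ hn.ne'] at he
    rw [show s = t by omega]

/-- Among the `i + 1` largest labels one is at most `k (n - i - 1)`, by `exists_PS_le`; this
suffices for the diagonal, as `n k ≤ k n + 1`. -/
lemma PS_mem_parkingFunctions [NeZero n] {ω : Equiv.Perm ℤ} (hω : ∀ x, ω (x + n) = ω x + n) :
    PS n (k * n + 1) ω ∈ parkingFunctions (k * n + 1) n := by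
  set f := PS n (k * n + 1) ω with hf
  set τ : Equiv.Perm (Fin n) := Fin.revPerm.trans (Tuple.sort f) with hτ
  have hanti : Antitone (f ∘ τ) := (Tuple.monotone_sort f).comp_antitone Fin.rev_anti
  refine ⟨τ, hanti, fun i => ?_⟩
  obtain ⟨a, ha, hle⟩ := exists_PS_le (k := k) hω
    (I := (Finset.Iic i).map τ.toEmbedding) ⟨τ i, by simp⟩
  rw [Finset.card_map, Fin.card_Iic] at hle
  obtain ⟨j, hj, rfl⟩ := Finset.mem_map.1 ha
  have h1 : f (τ i) ≤ k * (n - ((i : ℕ) + 1)) := (hanti (Finset.mem_Iic.1 hj)).trans hle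
  obtain ⟨d, hd⟩ := Nat.exists_eq_add_of_le (show (i : ℕ) + 1 ≤ n from i.2)
  have h2 : n - ((i : ℕ) + 1) = d := by omega
  rw [h2] at h1
  calc n * f (τ i) + (k * n + 1) * ((i : ℕ) + 1)
      ≤ n * (k * d) + (k * n + 1) * ((i : ℕ) + 1) := by gcongr
    _ ≤ (k * n + 1) * d + (k * n + 1) * ((i : ℕ) + 1) := Nat.add_le_add_right (by nlinarith) _
    _ = (k * n + 1) * n := by rw [← mul_add, add_comm d, ← hd]

/-- A parking function has many small values. -/
lemma mul_le_of_mem_parkingFunctions {f : Fin n → ℕ} (hf : f ∈ parkingFunctions m n) {v : ℕ}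
    (hv : v ≤ m) : n * v ≤ m * (Finset.univ.filter fun a => f a < v).card := by
  obtain ⟨τ, hanti, hτ⟩ := hf
  set N := (Finset.univ.filter fun i => v ≤ f (τ i)).card with hN
  have hN' : (Finset.univ.filter fun a => ¬ f a < v).card = N := by
    rw [hN]
    symm
    refine Finset.card_bij (fun i _ => τ i) (fun i hi => ?_) (fun i _ j _ h => τ.injective h)
      fun a ha => ⟨τ.symm a, ?_, by simp⟩
    · simpa using hi
    · simpa using ha
  have hsum := Finset.card_filter_add_card_filter_not (s := (Finset.univ : Finset (Fin n)))
    (fun a => f a < v)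
  rw [hN', Finset.card_univ, Fintype.card_fin] at hsum
  rcases Nat.eq_zero_or_pos N with h0 | h0
  · rw [show (Finset.univ.filter fun a => f a < v).card = n by omega, mul_comm]
    exact Nat.mul_le_mul_right n hv
  · have hlt : N - 1 < n := by omega
    -- The `N` values that are at least `v` occupy the lowest `N` rows; the diagonal condition in
    -- the last of them is the claim.
    have h1 : v ≤ f (τ ⟨N - 1, hlt⟩) := by
      by_contra hc
      have hsub : (Finset.univ.filter fun i => v ≤ f (τ i)) ⊆ Finset.Iio ⟨N - 1, hlt⟩ := by
        intro i hi
        rw [Finset.mem_Iio]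
        by_contra hi'
        have h2 := hanti (not_lt.1 hi')
        have h3 := (Finset.mem_filter.1 hi).2
        simp only [Function.comp] at h2
        omega
      have := Finset.card_le_card hsub
      rw [Fin.card_Iio, ← hN] at this
      simp only at this
      omega
    have h2 := hτ ⟨N - 1, hlt⟩
    simp only [show N - 1 + 1 = N by omega] at h2
    have h3 := Nat.mul_le_mul_left n h1
    have h4 := congrArg (m * ·) hsum
    simp only [mul_add] at h4
    omega

lemma lt_of_mem_parkingFunctions {f : Fin n → ℕ} (hm : 0 < m) (hf : f ∈ parkingFunctions m n)
    (a : Fin n) : f a < m := by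
  have h1 := mul_le_of_mem_parkingFunctions hf le_rfl
  rw [mul_comm] at h1
  have h2 := Nat.le_of_mul_le_mul_left h1 hm
  have h3 : (Finset.univ.filter fun a => f a < m) = Finset.univ :=
    Finset.eq_univ_of_card _ (le_antisymm (Finset.card_le_univ _) (by simpa using h2))
  have h4 := Finset.mem_univ a
  rw [← h3] at h4
  exact (Finset.mem_filter.1 h4).2

/-- Two parking functions that differ by a constant modulo `m` are equal. -/
lemma eq_of_mem_parkingFunctions [NeZero m] (hmn : m.Coprime n) {f g : Fin n → ℕ}
    (hf : f ∈ parkingFunctions m n) (hg : g ∈ parkingFunctions m n) {d : ZMod m}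
    (h : ∀ a, (g a : ZMod m) = f a + d) : f = g := by
  have hm := Nat.pos_of_ne_zero (NeZero.ne m)
  have hf' := lt_of_mem_parkingFunctions hm hf
  have hg' := lt_of_mem_parkingFunctions hm hg
  have hdlt := ZMod.val_lt d
  have h' : ∀ a, g a = (f a + d.val) % m := fun a => by
    rw [← Nat.mod_eq_of_lt (hg' a)]
    refine (ZMod.natCast_eq_natCast_iff' _ _ _).1 ?_
    push_cast
    rw [h, ZMod.natCast_zmod_val]
  have hd : d.val = 0 := by
    by_contra hd0
    -- The values of `g` below `d` are those of `f` that wrap around, `f ≥ m - d`. So the counts in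
    -- the two inequalities add up to `n`, the inequalities are equalities, and `n d = m G` forces
    -- `m ∣ d`.
    have h1 := mul_le_of_mem_parkingFunctions hf (Nat.sub_le m d.val)
    have h2 := mul_le_of_mem_parkingFunctions hg hdlt.le
    have h3 : (Finset.univ.filter fun a => g a < d.val) =
        Finset.univ.filter fun a => ¬ f a < m - d.val := by
      refine Finset.filter_congr fun a _ => ?_
      have ha := hf' a
      rw [h']
      rcases lt_or_ge (f a + d.val) m with hlt | hge
      · rw [Nat.mod_eq_of_lt hlt]; omega
      · rw [Nat.mod_eq_sub_mod hge, Nat.mod_eq_of_lt (by omega)]; omega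
    have hsum := Finset.card_filter_add_card_filter_not (s := (Finset.univ : Finset (Fin n)))
      (fun a => f a < m - d.val)
    rw [← h3, Finset.card_univ, Fintype.card_fin] at hsum
    set F := (Finset.univ.filter fun a => f a < m - d.val).card
    set G := (Finset.univ.filter fun a => g a < d.val).card
    have h4 : n * (m - d.val) + n * d.val = m * F + m * G := by
      rw [← mul_add, ← mul_add, Nat.sub_add_cancel hdlt.le, hsum, mul_comm]
    have h5 : n * d.val = m * G := by omega
    have h6 : m ∣ d.val := hmn.dvd_of_dvd_mul_left ⟨G, h5⟩
    exact hd0 (Nat.eq_zero_of_dvd_of_lt h6 hdlt)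
  ext a
  rw [h', hd, add_zero, Nat.mod_eq_of_lt (hf' a)]

/-- The vectors modulo `k n + 1` with the sum of the identity permutation. -/
def residueVectors (n m : ℕ) : Set (Fin n → ZMod m) :=
  {v | ∑ a, v a = ∑ a : Fin n, (pos a : ZMod m)}

lemma natCast_mul_natCast_eq_neg_one (n k : ℕ) : (k : ZMod (k * n + 1)) * n = -1 := by
  have := ZMod.natCast_self (k * n + 1)
  push_cast at this
  exact eq_neg_of_add_eq_zero_left this

lemma coprime_mul_add_one (n k : ℕ) : (k * n + 1).Coprime n := by
  rw [Nat.coprime_mul_right_add_left]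
  exact Nat.coprime_one_left n

lemma finite_parkingFunctions (hm : 0 < m) : (parkingFunctions m n).Finite :=
  (Set.finite_Iic fun _ : Fin n => m).subset fun _ hf a => (lt_of_mem_parkingFunctions hm hf a).le

/-- Since `k n = -1` modulo `m`, a translation by a multiple of `k` brings any vector to the
prescribed sum; parking functions that get the same image differ by a constant. -/
lemma ncard_parkingFunctions_le (n k : ℕ) :
    (parkingFunctions (k * n + 1) n).ncard ≤ (residueVectors n (k * n + 1)).ncard := by
  refine Set.ncard_le_ncard_of_injOn (fun f a => (f a : ZMod (k * n + 1)) -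
    k * (∑ a : Fin n, (pos a : ZMod (k * n + 1)) - ∑ a, (f a : ZMod (k * n + 1)))) (fun f _ => ?_)
    (fun f hf g hg he => ?_) (Set.toFinite _)
  · simp only [residueVectors, Set.mem_ofPred_eq, Finset.sum_sub_distrib, Finset.sum_const,
      Finset.card_univ, Fintype.card_fin, nsmul_eq_mul]
    have := natCast_mul_natCast_eq_neg_one n k
    linear_combination (- ∑ a : Fin n, (pos a : ZMod (k * n + 1)) +
      ∑ a, (f a : ZMod (k * n + 1))) * this
  · refine eq_of_mem_parkingFunctions (coprime_mul_add_one n k) hf hg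
      (d := k * (∑ a : Fin n, (pos a : ZMod (k * n + 1)) - ∑ a, (g a : ZMod (k * n + 1))) -
        k * (∑ a : Fin n, (pos a : ZMod (k * n + 1)) - ∑ a, (f a : ZMod (k * n + 1))))
      fun a => ?_
    have := congrFun he a
    simp only at this
    linear_combination -this

end Parking

/-! ### Order-preserving pairings and the rearrangement inequality -/

section Matching

variable {ι : Type*} {g h : ι → ℤ} {π ρ : Equiv.Perm ι}

/-- The permutation `π` carries the order of the values of `g` to that of the values of `h`. -/
def Matches (g h : ι → ℤ) (π : Equiv.Perm ι) : Prop := ∀ c d, g c < g d ↔ h (π c) < h (π d)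

lemma Matches.monovary (hπ : Matches g h π) : Monovary g (h ∘ π) := fun c d hcd =>
  ((hπ c d).2 hcd).le

variable [Fintype ι]

lemma exists_matches (hg : Function.Injective g) (hh : Function.Injective h) :
    ∃ π, Matches g h π := by
  set e := (Fintype.equivFin ι).symm
  set s := (Tuple.sort (g ∘ e)).trans e with hs
  set t := (Tuple.sort (h ∘ e)).trans e with ht
  have hgs : StrictMono (g ∘ s) :=
    (Tuple.monotone_sort (g ∘ e)).strictMono_of_injective (hg.comp s.injective)
  have hht : StrictMono (h ∘ t) :=
    (Tuple.monotone_sort (h ∘ e)).strictMono_of_injective (hh.comp t.injective)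
  refine ⟨s.symm.trans t, fun c d => ?_⟩
  obtain ⟨i, rfl⟩ := s.surjective c
  obtain ⟨j, rfl⟩ := s.surjective d
  simpa using (hgs.lt_iff_lt (a := i) (b := j)).trans hht.lt_iff_lt.symm

lemma Matches.card_filter (hπ : Matches g h π) (c : ι) :
    (Finset.univ.filter fun e => g e < g c).card =
      (Finset.univ.filter fun e => h e < h (π c)).card := by
  refine Finset.card_bij (fun e _ => π e) (fun e he => ?_) (fun _ _ _ _ he => π.injective he)
    fun e he => ⟨π.symm e, ?_, by simp⟩
  · simpa [← hπ e c] using he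
  · simpa [hπ (π.symm e) c] using he

/-- A matching sends an element to the element of the same rank. -/
lemma Matches.apply_eq (hh : Function.Injective h) (hπ : Matches g h π) {c c' : ι}
    (hc : (Finset.univ.filter fun e => g e < g c).card =
      (Finset.univ.filter fun e => h e < h c').card) : π c = c' := by
  rw [hπ.card_filter] at hc
  have key : ∀ a b : ι, h a < h b → (Finset.univ.filter fun e => h e < h a).card <
      (Finset.univ.filter fun e => h e < h b).card := fun a b hab => by
    refine Finset.card_lt_card ⟨fun e he => ?_, fun hsub => ?_⟩
    · simp only [Finset.mem_filter, Finset.mem_univ, true_and] at he ⊢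
      exact he.trans hab
    · have := hsub (show a ∈ Finset.univ.filter fun e => h e < h b by simpa using hab)
      simp at this
  by_contra hne
  rcases lt_or_gt_of_ne (hh.ne hne) with hlt | hlt
  · exact (key _ _ hlt).ne hc
  · exact (key _ _ hlt).ne' hc

lemma Matches.unique (hh : Function.Injective h) (hπ : Matches g h π) (hρ : Matches g h ρ) :
    π = ρ :=
  Equiv.ext fun c => hπ.apply_eq hh (hρ.card_filter c)

/-- The squared distance of two families paired by a permutation. -/
def energy (g h : ι → ℤ) (π : Equiv.Perm ι) : ℤ := ∑ c, (g c - h (π c)) ^ 2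

lemma energy_eq (g h : ι → ℤ) (π : Equiv.Perm ι) :
    energy g h π = ∑ c, g c ^ 2 + ∑ c, h c ^ 2 - 2 * ∑ c, g c * h (π c) := by
  rw [energy, ← Equiv.sum_comp π fun c => h c ^ 2, Finset.mul_sum, ← Finset.sum_add_distrib,
    ← Finset.sum_sub_distrib]
  exact Finset.sum_congr rfl fun _ _ => by ring

/-- A matching minimizes the energy. -/
lemma Matches.energy_le (hπ : Matches g h π) (ρ : Equiv.Perm ι) :
    energy g h π ≤ energy g h ρ := by
  -- Only the cross term of the energy depends on the permutation, so this is the rearrangement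
  -- inequality.
  have := hπ.monovary.sum_mul_comp_perm_le_sum_mul (σ := ρ.trans π.symm)
  simp only [Function.comp, Equiv.trans_apply, Equiv.apply_symm_apply] at this
  rw [energy_eq, energy_eq]
  linarith

/-- The matching is the only permutation of least energy. -/
lemma Matches.eq_of_energy_le (hg : Function.Injective g) (hh : Function.Injective h)
    (hπ : Matches g h π) (hle : energy g h ρ ≤ energy g h π) : π = ρ := by
  have heq := le_antisymm hle (hπ.energy_le ρ)
  rw [energy_eq, energy_eq] at heq
  have := hπ.monovary.sum_mul_comp_perm_eq_sum_mul_iff (σ := ρ.trans π.symm)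
  simp only [Function.comp, Equiv.trans_apply, Equiv.apply_symm_apply] at this
  have hm := this.1 (by linarith)
  refine hπ.unique hh fun c d => ⟨fun hcd => ?_, fun hcd => ?_⟩
  · have h1 : h (ρ c) ≤ h (ρ d) := by
      by_contra hn
      have h2 := hm (i := d) (j := c) (by simpa using hn)
      omega
    have h3 : h (ρ c) ≠ h (ρ d) := hh.ne (ρ.injective.ne (by rintro rfl; exact lt_irrefl _ hcd))
    omega
  · have h1 : g c ≤ g d := hm (i := c) (j := d) (by simpa using hcd)
    have h3 : g c ≠ g d := hg.ne (by rintro rfl; exact lt_irrefl _ hcd)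
    omega

end Matching

/-! ### The least positions of large values in the residue classes modulo `m` -/

section Generators

variable {n m : ℕ} {ω : Equiv.Perm ℤ} {α : ℤ} {g : ZMod m → ℤ}

/-- `g c` is the least position in the residue class `c` modulo `m` with a value larger than
`α`. -/
def IsGenerators (m : ℕ) (ω : Equiv.Perm ℤ) (α : ℤ) (g : ZMod m → ℤ) : Prop :=
  (∀ c, (g c : ZMod m) = c) ∧ ∀ x : ℤ, α < ω x ↔ g x ≤ x

lemma IsGenerators.injective (hg : IsGenerators m ω α g) : Function.Injective g :=
  fun c d h => by rw [← hg.1 c, ← hg.1 d, h]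

/-- The difference `f j - j` is monotone, which makes `f` unbounded in both directions. -/
lemma exists_threshold {f : ℤ → ℤ} (hf : StrictMono f) (α : ℤ) : ∃ j₀, ∀ j, α < f j ↔ j₀ ≤ j := by
  have hmono : Monotone fun j => f j - j :=
    monotone_int_of_le_succ fun j => by have := hf (lt_add_one j); omega
  obtain ⟨j₀, h1, h2⟩ := Int.exists_least_of_bdd (P := fun j => α < f j)
    ⟨min 0 (α - f 0), fun j hj => by
      rcases le_total 0 j with h | h
      · exact (min_le_left _ _).trans h
      · have := hmono h
        simp only at this
        exact (min_le_right _ _).trans (by omega)⟩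
    ⟨max 0 (α - f 0 + 1), by
      have := hmono (le_max_left 0 (α - f 0 + 1))
      simp only at this
      have := le_max_right 0 (α - f 0 + 1)
      omega⟩
  exact ⟨j₀, fun j => ⟨h2 j, fun hj => h1.trans_le (hf.monotone hj)⟩⟩

/-- Stability says that `ω` is strictly increasing along each residue class modulo `m`. -/
lemma exists_isGenerators (hω : ∀ x, ω x < ω (x + m)) (α : ℤ) : ∃ g, IsGenerators m ω α g := by
  have hex : ∀ c : ZMod m, ∃ y : ℤ, (y : ZMod m) = c ∧
      ∀ x : ℤ, (x : ZMod m) = c → (α < ω x ↔ y ≤ x) := fun c => by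
    obtain ⟨c₀, rfl⟩ := ZMod.intCast_surjective c
    have hm : (0 : ℤ) < m := by
      by_contra hm
      have := hω 0
      rw [show (m : ℤ) = 0 by omega] at this
      exact lt_irrefl _ this
    have hmono : StrictMono fun j : ℤ => ω (c₀ + j * m) := strictMono_int_of_lt_succ fun j => by
      have := hω (c₀ + j * m)
      rwa [show c₀ + (j + 1) * m = c₀ + j * m + m by ring]
    obtain ⟨j₀, hj₀⟩ := exists_threshold hmono α
    refine ⟨c₀ + j₀ * m, by simp, fun x hx => ?_⟩
    obtain ⟨j, hj⟩ := (ZMod.intCast_eq_intCast_iff_dvd_sub _ _ _).1 hx.symm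
    obtain rfl : x = c₀ + j * m := by linarith
    rw [hj₀, add_le_add_iff_left, mul_le_mul_iff_left₀ hm]
  choose g hg hg' using hex
  exact ⟨g, hg, fun x => hg' _ x rfl⟩

lemma IsGenerators.unique {g' : ZMod m → ℤ} (hg : IsGenerators m ω α g)
    (hg' : IsGenerators m ω α g') : g = g' := by
  have key : ∀ {g g' : ZMod m → ℤ}, IsGenerators m ω α g → IsGenerators m ω α g' →
      ∀ c, g c ≤ g' c := fun {g g'} hg hg' c => by
    have h1 := hg.2 (g' c)
    have h2 := hg'.2 (g' c)
    rw [hg'.1] at h1 h2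
    exact h1.1 (h2.2 le_rfl)
  exact funext fun c => le_antisymm (key hg hg' c) (key hg' hg c)

lemma IsGenerators.add (hω : ∀ x, ω (x + n) = ω x + n) (hg : IsGenerators m ω α g) :
    IsGenerators m ω (α + n) fun c => g (c - n) + n := by
  refine ⟨fun c => by push_cast; rw [hg.1]; ring, fun x => ?_⟩
  have h1 := hω (x - n)
  rw [sub_add_cancel] at h1
  have h2 := hg.2 (x - n)
  push_cast at h2
  rw [h1, add_lt_add_iff_right, h2, le_sub_iff_add_le]

lemma eq_of_intCast_eq {x y : ℤ} (h : (x : ZMod m) = y) (h1 : x - m < y) (h2 : y ≤ x) : x = y := by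
  obtain ⟨c, hc⟩ := (ZMod.intCast_eq_intCast_iff_dvd_sub _ _ _).1 h
  have hm : (0 : ℤ) < m := by omega
  have h3 : c = 0 := by
    have h4 : -1 < c := by nlinarith
    have h5 : c < 1 := by nlinarith
    omega
  rw [h3] at hc
  omega

/-- By stability the preceding position in the class has a value below `α + 1`, hence not above `α`.
-/
lemma IsGenerators.apply_inv (hst : ∀ x, ω x < ω (x + m)) (hg : IsGenerators m ω α g) :
    g ((ω⁻¹ (α + 1) : ℤ)) = ω⁻¹ (α + 1) := by
  set x := ω⁻¹ (α + 1) with hx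
  have hxv : ω x = α + 1 := perm_apply_inv _ _
  have h1 := (hg.2 x).1 (by omega)
  have h2 := (hg.2 (x - m)).not
  have h3 := hst (x - m)
  rw [sub_add_cancel] at h3
  rw [show (((x - m : ℤ)) : ZMod m) = x by push_cast; simp] at h2
  have h4 := h2.1 (by omega)
  exact (eq_of_intCast_eq (m := m) (hg.1 x).symm (by omega) h1).symm

/-- Only the position of the value `α + 1` leaves the set of positions with values above the
threshold, so a single generator moves, to the next position of its class. -/
lemma IsGenerators.succ (hst : ∀ x, ω x < ω (x + m)) (hg : IsGenerators m ω α g) :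
    IsGenerators m ω (α + 1) fun c => g c + if c = (ω⁻¹ (α + 1) : ℤ) then (m : ℤ) else 0 := by
  have hgx := hg.apply_inv hst
  set x := ω⁻¹ (α + 1) with hx
  have hxv : ω x = α + 1 := perm_apply_inv _ _
  refine ⟨fun c => ?_, fun y => ?_⟩
  · dsimp only
    split_ifs <;> simp [hg.1]
  have h1 : α + 1 < ω y ↔ α < ω y ∧ y ≠ x := by
    constructor
    · intro h
      exact ⟨by omega, by rintro rfl; omega⟩
    · rintro ⟨h, hne⟩
      have := ω.injective.ne hne
      omega
  rw [h1, hg.2]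
  dsimp only
  split_ifs with hc
  · rw [hc, hgx]
    constructor
    · rintro ⟨h2, h3⟩
      by_contra h4
      exact h3 (eq_of_intCast_eq hc (by omega) h2)
    · intro h
      have h5 : (0 : ℤ) < m := by
        have := hst x
        by_contra hm
        rw [show (m : ℤ) = 0 by omega, add_zero] at this
        exact lt_irrefl _ this
      omega
  · rw [add_zero]
    exact and_iff_left (by rintro rfl; exact hc rfl)

/-- The rank of the generator that is moved is the Pak–Stanley label. -/
lemma IsGenerators.card_filter [NeZero m] (hst : ∀ x, ω x < ω (x + m))
    (hg : IsGenerators m ω α g) :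
    (Finset.univ.filter fun c => g c < g ((ω⁻¹ (α + 1) : ℤ))).card =
      {β : ℤ | α + 1 < β ∧ 0 < ω⁻¹ (α + 1) - ω⁻¹ β ∧ ω⁻¹ (α + 1) - ω⁻¹ β < m}.ncard := by
  have hgx := hg.apply_inv hst
  have hm := cast_pos_of_neZero m
  rw [hgx, ← Set.ncard_coe_finset]
  set x := ω⁻¹ (α + 1) with hx
  symm
  refine Set.ncard_congr (fun β _ => ((ω⁻¹ β : ℤ) : ZMod m)) ?_ ?_ ?_
  · rintro β ⟨h1, h2, h3⟩
    have h4 := (hg.2 (ω⁻¹ β)).1 (by rw [perm_apply_inv]; omega)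
    simp only [Finset.coe_filter, Finset.mem_univ, true_and, Set.mem_ofPred_eq]
    omega
  · rintro β γ ⟨-, h2, h3⟩ ⟨-, h5, h6⟩ he
    apply ω⁻¹.injective
    rcases le_total (ω⁻¹ γ) (ω⁻¹ β) with h | h
    · exact eq_of_intCast_eq he (by omega) h
    · exact (eq_of_intCast_eq he.symm (by omega) h).symm
  · intro c hc
    simp only [Finset.coe_filter, Finset.mem_univ, true_and, Set.mem_ofPred_eq] at hc
    -- The inversion in the class `c` sits at the last position `y` of this class before `x`; `y = x
    -- - m` is excluded since the generator of the class of `x` is `x`.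
    set q := (x - 1 - g c) / m with hq
    set y := g c + q * m with hy
    have hq0 : 0 ≤ q := Int.ediv_nonneg (by omega) hm.le
    have hq1 : 0 ≤ q * m := by positivity
    have hq2 := Int.emod_nonneg (x - 1 - g c) hm.ne'
    have hq3 := Int.emod_lt_of_pos (x - 1 - g c) hm
    have hq4 := Int.emod_add_mul_ediv (x - 1 - g c) m
    rw [mul_comm, ← hq] at hq4
    have hyc : (y : ZMod m) = c := by simp [hy, hg.1]
    have hyx : y < x := by omega
    have hne : y ≠ x - m := by
      intro h
      have : c = (x : ZMod m) := by rw [← hyc, h]; push_cast; simp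
      rw [this, hgx] at hc
      exact lt_irrefl _ hc
    have hv : α < ω y := (hg.2 y).2 (by rw [hyc]; omega)
    have hv' : ω y ≠ α + 1 := fun h => by
      rw [← h, perm_inv_apply] at hx
      omega
    refine ⟨ω y, ⟨by omega, ?_, ?_⟩, ?_⟩
    · rw [perm_inv_apply]; omega
    · rw [perm_inv_apply]; omega
    · rw [perm_inv_apply]; exact hyc

lemma ncard_inversions_add (hω : ∀ x, ω (x + n) = ω x + n) (a : ℤ) :
    {β : ℤ | a + n < β ∧ 0 < ω⁻¹ (a + n) - ω⁻¹ β ∧ ω⁻¹ (a + n) - ω⁻¹ β < m}.ncard =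
      {β : ℤ | a < β ∧ 0 < ω⁻¹ a - ω⁻¹ β ∧ ω⁻¹ a - ω⁻¹ β < m}.ncard := by
  have h := equivariant_inv hω
  symm
  refine Set.ncard_congr (fun β _ => β + n) ?_ (fun _ _ _ _ he => add_right_cancel he) ?_
  · rintro β ⟨h1, h2, h3⟩
    refine ⟨by omega, ?_, ?_⟩ <;> rw [h, h] <;> omega
  · rintro β ⟨h1, h2, h3⟩
    have h4 := h (β - n)
    rw [sub_add_cancel] at h4
    rw [h, h4] at h2 h3
    exact ⟨β - n, ⟨by omega, by omega, by omega⟩, by ring⟩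

lemma ncard_inversions_eq [NeZero n] {ω' : Equiv.Perm ℤ} (hω : ∀ x, ω (x + n) = ω x + n)
    (hω' : ∀ x, ω' (x + n) = ω' x + n) (h : PS n m ω = PS n m ω') (a : ℤ) :
    {β : ℤ | a < β ∧ 0 < ω⁻¹ a - ω⁻¹ β ∧ ω⁻¹ a - ω⁻¹ β < m}.ncard =
      {β : ℤ | a < β ∧ 0 < ω'⁻¹ a - ω'⁻¹ β ∧ ω'⁻¹ a - ω'⁻¹ β < m}.ncard := by
  obtain ⟨i, t, rfl⟩ := exists_eq_pos_add (n := n) a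
  have h1 := map_add_mul_of_map_add (N := n) (c := 0)
    (f := fun a => ({β : ℤ | a < β ∧ 0 < ω⁻¹ a - ω⁻¹ β ∧ ω⁻¹ a - ω⁻¹ β < m}.ncard : ℤ))
    (fun a => by rw [ncard_inversions_add hω, add_zero]) (pos i) t
  have h2 := map_add_mul_of_map_add (N := n) (c := 0)
    (f := fun a => ({β : ℤ | a < β ∧ 0 < ω'⁻¹ a - ω'⁻¹ β ∧ ω'⁻¹ a - ω'⁻¹ β < m}.ncard : ℤ))
    (fun a => by rw [ncard_inversions_add hω', add_zero]) (pos i) t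
  simp only [smul_zero, add_zero, Nat.cast_inj] at h1 h2
  rw [h1, h2]
  exact congrFun h i

end Generators

/-! ### Injectivity of the Pak–Stanley map by the energy argument -/

section Injective

variable {n k : ℕ} [NeZero n]

/-- The energy of the matched generators of two stable permutations with the same label never
increases, and it is periodic, so that the matching never changes. -/
lemma injOn_PS : Set.InjOn (PS n (k * n + 1)) (stablePerms n (k * n + 1)) := by
  intro ω h ω' h' hPS
  have hω := h.1.1
  have hω' := h'.1.1
  choose g hg using exists_isGenerators h.2
  choose g' hg' using exists_isGenerators h'.2
  choose π hπ using fun α => exists_matches (hg α).injective (hg' α).injective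
  set c : ℤ → ZMod (k * n + 1) := fun α => (ω⁻¹ (α + 1) : ℤ) with hc
  set c' : ℤ → ZMod (k * n + 1) := fun α => (ω'⁻¹ (α + 1) : ℤ) with hc'
  -- Equal labels mean that the moving generators have equal rank, so the matching pairs them; both
  -- jump by `m` and all paired differences survive.
  have hcc : ∀ α, π α (c α) = c' α := fun α => by
    refine (hπ α).apply_eq (hg' α).injective ?_
    rw [(hg α).card_filter h.2, (hg' α).card_filter h'.2, ncard_inversions_eq hω hω' hPS]
  have hsucc : ∀ α, g (α + 1) = fun e => g α e + if e = c α then ((k * n + 1 : ℕ) : ℤ) else 0 :=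
    fun α => (hg (α + 1)).unique ((hg α).succ h.2)
  have hsucc' : ∀ α, g' (α + 1) = fun e => g' α e + if e = c' α then ((k * n + 1 : ℕ) : ℤ) else 0 :=
    fun α => (hg' (α + 1)).unique ((hg' α).succ h'.2)
  have hdiff : ∀ α e, g (α + 1) e - g' (α + 1) (π α e) = g α e - g' α (π α e) := fun α e => by
    have hiff : π α e = c' α ↔ e = c α := by rw [← hcc, (π α).injective.eq_iff]
    rw [hsucc, hsucc']
    simp only [hiff]
    ring
  have hstep : ∀ α, energy (g (α + 1)) (g' (α + 1)) (π α) = energy (g α) (g' α) (π α) := fun α =>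
    Finset.sum_congr rfl fun e _ => by rw [hdiff]
  have hadd : ∀ α, g (α + n) = fun e => g α (e - n) + n := fun α =>
    (hg (α + n)).unique ((hg α).add hω)
  have hadd' : ∀ α, g' (α + n) = fun e => g' α (e - n) + n := fun α =>
    (hg' (α + n)).unique ((hg' α).add hω')
  have hπadd : ∀ α e, π (α + n) e = π α (e - n) + n := fun α e => by
    have hm : Matches (g (α + n)) (g' (α + n))
        ((Equiv.subRight (n : ZMod (k * n + 1))).trans ((π α).trans (Equiv.addRight (n : ZMod (k * n + 1))))) := by
      intro e e'
      rw [hadd, hadd']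
      simpa using hπ α (e - n) (e' - n)
    rw [(hπ (α + n)).unique (hg' (α + n)).injective hm]
    rfl
  have hdadd : ∀ α e, g (α + n) e - g' (α + n) (π (α + n) e) =
      g α (e - n) - g' α (π α (e - n)) := fun α e => by
    rw [hπadd, hadd, hadd']
    simp
  have hEadd : ∀ α, energy (g (α + n)) (g' (α + n)) (π (α + n)) = energy (g α) (g' α) (π α) :=
    fun α => by
    simp only [energy, hdadd]
    exact (Equiv.subRight (n : ZMod (k * n + 1))).sum_comp fun e => (g α e - g' α (π α e)) ^ 2
  have hanti : Antitone fun α => energy (g α) (g' α) (π α) := antitone_int_of_succ_le fun α =>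
    ((hπ (α + 1)).energy_le (π α)).trans_eq (hstep α)
  -- The old matching has energy `E(α) = E(α + n) ≤ E(α + 1)` at `α + 1`, so it attains the minimum
  -- there, and the minimizer is unique.
  have hπsucc : ∀ α, π (α + 1) = π α := fun α => by
    refine (hπ (α + 1)).eq_of_energy_le (hg (α + 1)).injective (hg' (α + 1)).injective ?_
    rw [hstep, ← hEadd]
    exact hanti (by have := cast_pos_of_neZero n; omega)
  set d : ℤ → ZMod (k * n + 1) → ℤ := fun α e => g α e - g' α (π α e) with hd
  have hdconst : ∀ α, d α = d 0 := fun α => by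
    have := map_add_mul_of_map_add (f := d) (N := 1) (c := 0) (fun α => by
      rw [add_zero]; ext e; simp only [hd]; rw [hπsucc, hdiff]) 0 α
    simpa using this
  have hdsub : ∀ e, d 0 e = d 0 (e - n) := fun e => by
    exact (congrFun (hdconst (0 + n)) e).symm.trans (hdadd 0 e)
  have hdsub' : ∀ (j : ℕ) e, d 0 (e - j * n) = d 0 e := fun j => by
    induction j with
    | zero => simp
    | succ j ih => intro e; rw [← ih e, hdsub (e - j * n)]; congr 1; push_cast; ring
  -- The differences are invariant under the shift by `n`, and `k` such shifts amount to a shift by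
  -- `-1` modulo `m`.
  have hdadd1 : ∀ e, d 0 (e + 1) = d 0 e := fun e => by
    rw [← hdsub' k e, natCast_mul_natCast_eq_neg_one, sub_neg_eq_add]
  have hd0 : ∀ e, d 0 e = d 0 0 := fun e => by
    have : ∀ j : ℕ, d 0 (j : ZMod (k * n + 1)) = d 0 0 := fun j => by
      induction j with
      | zero => simp
      | succ j ih => rw [Nat.cast_succ, hdadd1, ih]
    rw [← ZMod.natCast_zmod_val e, this]
  refine eq_of_forall_eq_add h.1 h'.1 (d := d 0 0) fun a => ?_
  have h1 := (hg (a - 1)).apply_inv h.2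
  have h2 := (hg' (a - 1)).apply_inv h'.2
  have h3 := hcc (a - 1)
  have h4 : d (a - 1) (c (a - 1)) = d 0 0 := by rw [hdconst, hd0]
  simp only [hd, h3] at h4
  simp only [hc, hc'] at h4
  rw [h1, h2, sub_add_cancel] at h4
  simp only [hd]
  linarith

end Injective

/-! ### Stable permutations with prescribed residues, and the final count -/

section Surjective

variable {n k : ℕ} [NeZero n]

/-- The residues modulo `k n + 1` of the positions of `1, …, n` are arbitrary, up to the
normalization of their sum. -/
lemma exists_stablePerm {m : ℕ} (hm : m = k * n + 1) {v : Fin n → ZMod m}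
    (hv : v ∈ residueVectors n m) :
    ∃ ω ∈ stablePerms n m, (fun a => ((ω⁻¹ (pos a) : ℤ) : ZMod m)) = v := by
  have hn := cast_pos_of_neZero n
  have hnk : (k : ZMod m) * n = -1 := by
    rw [hm]; exact natCast_mul_natCast_eq_neg_one n k
  have hcop : IsCoprime (m : ℤ) n :=
    Nat.isCoprime_iff_coprime.2 (hm ▸ coprime_mul_add_one n k)
  have hm0 : (0 : ℤ) < m := by rw [hm]; positivity
  -- The factor `-k` inverts `n` modulo `m`.
  choose s hs using fun a => ZMod.intCast_surjective (-(k : ZMod m) * v a)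
  have hsn : ∀ a, (s a : ZMod m) * n = v a := fun a => by
    rw [hs]; linear_combination -(v a) * hnk
  -- The inverse of `τ` below sends `m * ρ x + q * n` to `h x + q * n`. Since `ρ` ranks the values
  -- of `h`, advancing the position by `m` advances the rank by one and increases the value: this is
  -- stability.
  set h : ℤ → ℤ := fun x => pos (res n x) + (-s (res n x) + m * ((x - 1) / n)) * n with hh
  have hval : ∀ (i : Fin n) (t : ℤ), h (pos i + t * n) = pos i + (-s i + m * t) * n :=
    fun i t => by simp only [hh, res_pos_add, div_pos_add]
  have hinj : Function.Injective h := fun x y hxy => by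
    obtain ⟨i, t, rfl⟩ := exists_eq_pos_add (n := n) x
    obtain ⟨j, u, rfl⟩ := exists_eq_pos_add (n := n) y
    rw [hval, hval] at hxy
    obtain ⟨rfl, h2⟩ := pos_add_inj hxy
    rw [mul_left_cancel₀ hm0.ne' (by linarith : (m : ℤ) * t = m * u)]
  obtain ⟨ρ, hρ, ho⟩ := exists_rank (n := n) (h := fun x => (h x : ℝ)) (N := m * n)
    (Int.cast_injective.comp hinj) (by exact_mod_cast mul_pos hm0 hn) (fun x => by
      obtain ⟨i, t, rfl⟩ := exists_eq_pos_add (n := n) x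
      rw [show pos i + t * n + (n : ℤ) = pos i + (t + 1) * n by ring, hval, hval]
      push_cast
      ring)
  set τ : ℤ → ℤ := fun x => m * ρ (pos (res n x)) + (s (res n x) + (x - 1) / n) * n with hτ
  have hτval : ∀ (i : Fin n) (t : ℤ), τ (pos i + t * n) = m * ρ (pos i) + (s i + t) * n :=
    fun i t => by simp only [hτ, res_pos_add, div_pos_add]
  have hτpos : ∀ i : Fin n, τ (pos i) = m * ρ (pos i) + s i * n := fun i => by
    simpa using hτval i 0
  have hτadd : ∀ x, τ (x + n) = τ x + n := fun x => by
    obtain ⟨i, t, rfl⟩ := exists_eq_pos_add (n := n) x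
    rw [show pos i + t * n + (n : ℤ) = pos i + (t + 1) * n by ring, hτval, hτval]
    ring
  have hτinj : Function.Injective τ := fun x y hxy => by
    obtain ⟨i, t, rfl⟩ := exists_eq_pos_add (n := n) x
    obtain ⟨j, u, rfl⟩ := exists_eq_pos_add (n := n) y
    rw [hτval, hτval] at hxy
    obtain ⟨e, he⟩ := hcop.symm.dvd_of_dvd_mul_left
      (⟨s j + u - s i - t, by linarith⟩ : (n : ℤ) ∣ m * (ρ (pos i) - ρ (pos j)))
    have h1 : ρ (pos i + 0 * n) = ρ (pos j + e * n) := by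
      rw [equivariant_add_mul hρ, equivariant_add_mul hρ]; linarith
    obtain ⟨rfl, -⟩ := pos_add_inj (ρ.injective h1)
    rw [mul_right_cancel₀ hn.ne' (by linarith : t * (n : ℤ) = u * n)]
  -- The prescribed sum gives divisibility by `m`, equivariance by `n`. So normalization takes a
  -- translation by a multiple of `m`, which keeps the residues.
  have hdvd : (m : ℤ) * n ∣ ∑ a : Fin n, τ (pos a) - ∑ a : Fin n, pos a := by
    refine hcop.mul_dvd ?_ (dvd_sum_sub_sum_pos hτinj hτadd)
    rw [← Int.modEq_iff_dvd, ← ZMod.intCast_eq_intCast_iff]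
    push_cast
    rw [← show ∑ a, v a = ∑ a : Fin n, (pos a : ZMod m) from hv]
    exact Finset.sum_congr rfl fun a _ => by rw [hτpos]; push_cast; rw [hsn]; simp
  obtain ⟨e, he⟩ := hdvd
  set σ : Equiv.Perm ℤ := (Equiv.ofBijective τ
    ⟨hτinj, surjective_of_equivariant hτinj hτadd⟩).trans (Equiv.subRight (m * e)) with hσ
  have hσval : ∀ x, σ x = τ x - m * e := fun x => rfl
  have haff : IsAffinePerm n σ := by
    refine isAffinePerm_iff.2 ⟨fun x => by rw [hσval, hσval, hτadd]; ring, ?_⟩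
    simp only [hσval, Finset.sum_sub_distrib, Finset.sum_const, Finset.card_univ,
      Fintype.card_fin, nsmul_eq_mul]
    linarith
  refine ⟨σ⁻¹, ⟨haff.inv, fun x => ?_⟩, ?_⟩
  · obtain ⟨i, t, hi⟩ := exists_eq_pos_add (n := n) (σ⁻¹ x)
    obtain ⟨j, u, hj⟩ := exists_eq_pos_add (n := n) (σ⁻¹ (x + m))
    have h1 : σ (pos i + t * n) = x := by rw [← hi, perm_apply_inv]
    have h2 : σ (pos j + u * n) = x + m := by rw [← hj, perm_apply_inv]
    rw [hσval, hτval] at h1 h2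
    rw [hi, hj]
    obtain ⟨c, hc⟩ := hcop.dvd_of_dvd_mul_right
      (⟨ρ (pos j) - ρ (pos i) - 1, by linarith⟩ : (m : ℤ) ∣ (s i + t - s j - u) * n)
    have h3 : ρ (pos j) = ρ (pos i) + 1 + c * n := by
      have h4 : (m : ℤ) * (ρ (pos j) - ρ (pos i) - 1) = m * (c * n) := by
        rw [← mul_assoc, ← hc]; linarith
      linarith [mul_left_cancel₀ hm0.ne' h4]
    have h5 : ρ (pos i + 0 * n) < ρ (pos j + -c * n) := by
      rw [equivariant_add_mul hρ, equivariant_add_mul hρ]; linarith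
    rw [ho, Int.cast_lt, hval, hval] at h5
    have h6 : (-s j + m * -c) * (n : ℤ) = (u - s i - t) * n := by
      rw [mul_neg, ← hc]; ring
    rw [h6] at h5
    linarith
  · ext a
    rw [inv_inv, hσval, hτpos]
    push_cast
    rw [hsn]
    simp

lemma finite_stablePerms : (stablePerms n (k * n + 1)).Finite :=
  Set.Finite.of_injOn (fun _ h => PS_mem_parkingFunctions h.1.1) injOn_PS
    (finite_parkingFunctions (Nat.succ_pos _))

lemma ncard_residueVectors_le :
    (residueVectors n (k * n + 1)).ncard ≤ (stablePerms n (k * n + 1)).ncard :=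
  (Set.ncard_le_ncard (fun _ hv => exists_stablePerm rfl hv) (finite_stablePerms.image _)).trans
    (Set.ncard_image_le finite_stablePerms)

/-- An injection into a finite set is onto once the target is no larger than the source; the residue
vectors mediate between the two cardinalities. -/
lemma bijOn_PS : Set.BijOn (PS n (k * n + 1)) (stablePerms n (k * n + 1))
    (parkingFunctions (k * n + 1) n) := by
  have hmaps : Set.MapsTo (PS n (k * n + 1)) (stablePerms n (k * n + 1))
      (parkingFunctions (k * n + 1) n) := fun _ h => PS_mem_parkingFunctions h.1.1
  refine ⟨hmaps, injOn_PS, (Set.eq_of_subset_of_ncard_le hmaps.image_subset ?_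
    (finite_parkingFunctions (Nat.succ_pos _))).ge⟩
  rw [injOn_PS.ncard_image]
  exact (ncard_parkingFunctions_le n k).trans ncard_residueVectors_le

end Surjective

end ShiParking

/-- For `m = k n + 1`: `ω(A₀)` is the minimal alcove of the `k`-Shi region `alc ω` for every
`m`-stable `ω`, the map `alc` is a bijection onto the `k`-Shi regions, `λ ∘ alc = PS`, and `PS` is
a bijection onto the `m/n`-parking functions. -/
theorem mainTheorem3 (n k : ℕ) [NeZero n] :
    (∀ ω ∈ ShiParking.stablePerms n (k * n + 1),
      ShiParking.alc n k ω ∈ ShiParking.shiRegions n k ∧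
        ShiParking.IsMinimalAlcove n (ShiParking.alc n k ω) (ShiParking.alcove n ω)) ∧
    Set.BijOn (ShiParking.alc n k) (ShiParking.stablePerms n (k * n + 1))
      (ShiParking.shiRegions n k) ∧
    (∀ ω ∈ ShiParking.stablePerms n (k * n + 1),
      ShiParking.pakStanley n k (ShiParking.alc n k ω) = ShiParking.PS n (k * n + 1) ω) ∧
    Set.BijOn (ShiParking.PS n (k * n + 1)) (ShiParking.stablePerms n (k * n + 1))
      (ShiParking.parkingFunctions (k * n + 1) n) :=
  ⟨fun _ h => ⟨ShiParking.alc_mem_shiRegions h, ShiParking.isMinimalAlcove_alc h⟩,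
    ShiParking.bijOn_alc, fun _ h => ShiParking.pakStanley_alc h, ShiParking.bijOn_PS⟩
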